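/- Let $\Gamma$ be a finite oriented graph with vertex set $V$ and edge set $E$ (parallel edges and edges from a vertex to itself are allowed). For an edge $e$ write $e^{-1}$ for the reversed edge, and $s(\cdot),t(\cdot)$ for the starting and terminal vertices, so $s(e^{-1})=t(e)$. Assign spinors $z_e,z_{e^{-1}}\in\mathbb C^2$ to each $e\in E$. For $z,w\in\mathbb C^2$ put $[z|w\rangle=z_0w_1-z_1w_0$, $\check w=(-\overline{w_1},\overline{w_0})$, $d\mu(w)=\pi^{-2}e^{-|w_0|^2-|w_1|^2}d^4w$. *Coherent amplitude.* With $dg$ the normalized Haar measure of $SU(2)$ and $J_v=\sum_{s(e)=v}j_e+\sum_{t(e)=v}j_e$, $$\mathcal A_\Gamma(z)=\sum_{(j_e)}\ \prod_{v\in V}(J_v+1)!\int\prod_{v\in V}dg_v\prod_{e\in E}\frac{[z_e|g_{s(e)}g_{t(e)}^{-1}|z_{e^{-1}}\rangle^{2j_e}}{(2j_e)!},$$ the sum being over all $j_e\in\{0,\tfrac12,1,\dots\}$, with $(J+1)!:=\Gamma(J+2)$ (the Gamma function); the integral vanishes unless all $J_v$ are integers. *Generating functional.* For parameters $\tau^v_{ee'}=-\tau^v_{e'e}$,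 indexed by directed edges $e,e'$ (edges of $\Gamma$ or their reverses) starting at the same vertex $v$, $$\mathcal G_\Gamma(\tau)=\int\prod_{e\in E}d\mu(w_e)\prod_{v\in V}\exp\Big(\sum_{i<j}\tau^v_{ij}[w_i|w_j\rangle\Big),$$ where $i,j$ run over the directed edges starting at $v$, listed in any order, and $w_{e^{-1}}:=\check w_e$ for $e\in E$. *Loops and cycles.* A simple loop is a cyclic sequence $\ell=(e_1,\dots,e_n)$, $n\ge1$, of directed edges with $t(e_i)=s(e_{i+1})$, $t(e_n)=s(e_1)$, in which every edge of $\Gamma$ is used at most once (in one of its two directions); loops differing by the choice of first edge or by reversal $(e_n^{-1},\dots,e_1^{-1})$ are identified. It is a non-trivial cycle if the $s(e_i)$ are pairwise distinct. Put $$A_\ell(\tau)=-(-1)^{|e|}\,\tau_{e_1^{-1}e_2}\tau_{e_2^{-1}e_3}\cdots\tau_{e_n^{-1}e_1},$$ where $|e|$ is the number of $e_i$ that agree with the orientation of $\Gamma$, and $A_L(\tau)=\prod_{\ell\in L}A_\ell(\tau)$ for a collection $L$ of simple loops. A disjoint cycle union $C$ is a non-empty collection of non-trivial cycles, pairwise without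 common edges or vertices. Write $A_C(z)$ for $A_C(\tau)$ at $\tau^v_{ee'}=[z_e|z_{e'}\rangle$, and $D(z)=1+\sum_C A_C(z)$, the sum being over all disjoint cycle unions of $\Gamma$. **Statement.** Let $\tau^v_{ee'}=[z_e|z_{e'}\rangle$ whenever $s(e)=s(e')=v$. 1. There is $\delta>0$, depending on $\Gamma$, such that if all spinors have norm less than $\delta$, the integral $\mathcal G_\Gamma(\tau)$ and the sum $\mathcal A_\Gamma(z)$ converge absolutely, $D(z)\ne0$, and $$\mathcal G_\Gamma(\tau)=\frac1{\bigl(1+\sum_C A_C(z)\bigr)^2}=\mathcal A_\Gamma(z).$$ More generally, for arbitrary spinors, $D(z)\neq 0$ and the first equality holds whenever the integral converges absolutely, and $D(z)\ne0$ and the second equality holds whenever the sum converges absolutely. 2. These $\tau$ satisfy the Plücker relations: $\tau_{12}\tau_{34}+\tau_{13}\tau_{42}+\tau_{14}\tau_{23}=0$ for any four directed edges with the same starting vertex. For every $\tau$ satisfying the Plücker relations, the following cancellation holds. Let $U=(e_1,\dots,e_{i-1},e_i,\dots,e_n)$, $1<i\le n$, be a simple loop with $s(e_1)=s(e_i)=v$.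 Then $T=(e_1,\dots,e_{i-1},e_n^{-1},\dots,e_i^{-1})$ is a simple loop, $S$ consists of the two simple loops $(e_1,\dots,e_{i-1})$, $(e_i,\dots,e_n)$, and $$A_S(\tau)+A_T(\tau)+A_U(\tau)=0 .$$ 3. Only disjoint cycle unions survive: $1+\sum_L A_L(\tau)=1+\sum_C A_C(z)$, where $L$ runs over all non-empty collections of simple loops that pairwise have no edge in common (they may meet at vertices). -/

import Mathlib

open MeasureTheory

namespace SpinNetwork

/-! ### Spinors -/

/-- A spinor `|z⟩ = (z₀, z₁)`. -/
abbrev Spinor : Type := Fin 2 → ℂ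

/-- The holomorphic bracket `[z|w⟩ = z₀ w₁ - z₁ w₀`. -/
def bracket (z w : Spinor) : ℂ := z 0 * w 1 - z 1 * w 0

/-- The conjugate spinor `|w] = (-conj w₁, conj w₀)`. -/
def conjSpinor (w : Spinor) : Spinor := ![-(starRingEnd ℂ) (w 1), (starRingEnd ℂ) (w 0)]

/-- The Gaussian (Bargmann) measure `dμ(w) = π⁻² exp(-⟨w|w⟩) d⁴w` on `ℂ²`. -/
noncomputable def bargmann : Measure Spinor :=
  (volume : Measure Spinor).withDensity fun w =>
    ENNReal.ofReal ((Real.pi ^ 2)⁻¹ * Real.exp (-(‖w 0‖ ^ 2 + ‖w 1‖ ^ 2)))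

/-! ### The group `SU(2)` with its normalized Haar measure -/

/-- The group `SU(2)`. -/
abbrev SU2 : Type := Matrix.specialUnitaryGroup (Fin 2) ℂ

instance : IsTopologicalGroup SU2 where
  continuous_mul := continuous_mul
  continuous_inv := by
    refine Continuous.subtype_mk (f := fun A : SU2 => star (A : Matrix (Fin 2) (Fin 2) ℂ)) ?_ _
    exact continuous_star.comp continuous_subtype_val

instance : CompactSpace SU2 := by
  refine isCompact_iff_compactSpace.mp ?_
  have hK : IsCompact (Set.univ.pi fun _ : Fin 2 =>
      (Set.univ.pi fun _ : Fin 2 => Metric.closedBall (0 : ℂ) 1)) :=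
    isCompact_univ_pi fun _ => isCompact_univ_pi fun _ => isCompact_closedBall 0 1
  refine IsCompact.of_isClosed_subset (X := Matrix (Fin 2) (Fin 2) ℂ) hK ?_ ?_
  · have hc : IsClosed {A : Matrix (Fin 2) (Fin 2) ℂ | star A * A = 1 ∧ A * star A = 1 ∧ A.det = 1} := by
      refine IsClosed.and ?_ (IsClosed.and ?_ ?_)
      · exact isClosed_eq (continuous_star.mul continuous_id) continuous_const
      · exact isClosed_eq (continuous_id.mul continuous_star) continuous_const
      · exact isClosed_eq (continuous_id.matrix_det) continuous_const
    convert hc using 1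
    ext A
    simp only [SetLike.mem_coe, Matrix.mem_specialUnitaryGroup_iff, Set.mem_ofPred_eq,
      Unitary.mem_iff, Matrix.unitaryGroup, and_assoc]
  · intro A hA i _ j _
    rw [mem_closedBall_zero_iff]
    exact entry_norm_bound_of_unitary hA.1 i j

noncomputable instance : MeasurableSpace SU2 := borel SU2

instance : BorelSpace SU2 := ⟨rfl⟩

/-- The normalized Haar measure on `SU(2)` (total mass one on the compact group). -/
noncomputable def haarSU2 : Measure SU2 := Measure.haarMeasure ⊤

/-! ### Oriented graphs -/

/-- An oriented graph; parallel edges and edges from a vertex to itself are allowed.  It is finite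
when `V` and `E` are. -/
structure OGraph (V E : Type*) where
  /-- the starting vertex of an edge -/
  src : E → V
  /-- the terminal vertex of an edge -/
  tgt : E → V

/-- An edge with a direction of traversal: `(e, true)` is `e` and `(e, false)` is `e⁻¹`. -/
abbrev Dart (E : Type*) : Type _ := E × Bool

/-- `e ↦ e⁻¹`. -/
def Dart.inv {E : Type*} (d : Dart E) : Dart E := (d.1, !d.2)

/-- Parameters `τ_{ee'} = - τ_{e'e}`, skew-symmetric in two directed edges. Only the values at two
directed edges with the same starting vertex `v` matter; these are the numbers `τ^v_{ee'}`. -/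
structure Param (E : Type*) where
  /-- the value at two directed edges -/
  τ : Dart E → Dart E → ℂ
  skew : ∀ a b, τ b a = -τ a b

/-- The parameters `τ_{ee'} = [z_e|z_{e'}⟩`. -/
def spinorParam {E : Type*} (z : Dart E → Spinor) : Param E where
  τ a b := bracket (z a) (z b)
  skew a b := by simp only [bracket]; ring

section Lists

variable {E : Type*}

@[simp] theorem Dart.inv_inv (d : Dart E) : d.inv.inv = d := by
  simp [Dart.inv]

/-- The same sequence of edges, traversed backwards: `(e₁, …, eₙ) ↦ (eₙ⁻¹, …, e₁⁻¹)`. -/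
def revPath (l : List (Dart E)) : List (Dart E) := (l.map Dart.inv).reverse

theorem revPath_revPath (l : List (Dart E)) : revPath (revPath l) = l := by
  simp [revPath, List.map_reverse, Function.comp_def]

theorem revPath_isRotated {l l' : List (Dart E)} (h : l.IsRotated l') :
    (revPath l).IsRotated (revPath l') := by
  exact (h.map Dart.inv).reverse

/-- The amplitude of a closed sequence of directed edges,
`-(-1)^{|e|} τ_{e₁⁻¹ e₂} τ_{e₂⁻¹ e₃} ⋯ τ_{eₙ⁻¹ e₁}`, with `|e|` the number of edges that are traversed
along the orientation of the graph. -/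
def pathAmp (T : Param E) (l : List (Dart E)) : ℂ :=
  -(-1) ^ (l.countP fun d => d.2) * (List.zipWith (fun a b => T.τ a.inv b) l (l.rotate 1)).prod

theorem pathAmp_rotated (T : Param E) {l l' : List (Dart E)} (h : l.IsRotated l') :
    pathAmp T l = pathAmp T l' := by
  obtain ⟨n, rfl⟩ := h
  unfold pathAmp
  have h1 : (l.rotate n).countP (fun d => d.2) = l.countP (fun d => d.2) :=
    (List.rotate_perm l n).countP_eq _
  have h2 : (l.rotate n).rotate 1 = (l.rotate 1).rotate n := by
    rw [List.rotate_rotate, List.rotate_rotate, add_comm]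
  rw [h1, h2, ← List.zipWith_rotate_distrib _ _ _ _ (by simp), (List.rotate_perm _ n).prod_eq]

theorem prod_zipWith_swap (f g : Dart E → Dart E → ℂ) (hfg : ∀ a b, g b a = -f a b) :
    ∀ l l' : List (Dart E), l.length = l'.length →
      (List.zipWith g l' l).prod = (-1) ^ l.length * (List.zipWith f l l').prod
  | [], [], _ => by simp
  | a :: l, b :: l', h => by
      simp only [List.zipWith_cons_cons, List.prod_cons, List.length_cons,
        prod_zipWith_swap f g hfg l l' (by simpa using h), hfg, pow_succ]
      ring

theorem countP_inv (l : List (Dart E)) :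
    (l.map Dart.inv).countP (fun d => d.2) + l.countP (fun d => d.2) = l.length := by
  induction l with
  | nil => simp
  | cons a l ih =>
    rcases a with ⟨e, _ | _⟩ <;> simp [Dart.inv] at ih ⊢ <;> omega

theorem pathAmp_revPath (T : Param E) (l : List (Dart E)) :
    pathAmp T (revPath l) = pathAmp T l := by
  have hrot : revPath (l.rotate 1) = ((l.map Dart.inv).rotate 1).reverse := by
    rw [revPath, List.map_rotate]
  have h0 : pathAmp T (revPath l) = pathAmp T (revPath (l.rotate 1)) :=
    pathAmp_rotated T (revPath_isRotated ⟨1, rfl⟩)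
  have hback : (revPath (l.rotate 1)).rotate 1 = revPath l := by
    rcases l with _ | ⟨a, l⟩
    · simp [revPath]
    · simp [revPath]
  rw [h0]
  unfold pathAmp
  rw [hback]
  have hc : (revPath (l.rotate 1)).countP (fun d => d.2) + l.countP (fun d => d.2) = l.length := by
    rw [hrot, (List.reverse_perm _).countP_eq, (List.rotate_perm _ 1).countP_eq, countP_inv]
  have hz : (List.zipWith (fun a b => T.τ a.inv b) (revPath (l.rotate 1)) (revPath l)).prod
      = (-1) ^ l.length * (List.zipWith (fun a b => T.τ a.inv b) l (l.rotate 1)).prod := by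
    rw [revPath, revPath, ← List.reverse_zipWith (by simp), (List.reverse_perm _).prod_eq,
      List.zipWith_map]
    exact prod_zipWith_swap _ _ (fun a b => by simpa using T.skew a.inv b) _ _ (by simp)
  rw [hz, ← hc, pow_add, ← mul_assoc, neg_mul, neg_mul]
  have hs : ((-1 : ℂ) ^ ((revPath (l.rotate 1)).countP fun d => d.2)) *
      (-1) ^ ((revPath (l.rotate 1)).countP fun d => d.2) = 1 := by
    rw [← mul_pow]; simp
  rw [← mul_assoc, hs, one_mul, neg_mul]

end Lists

namespace OGraph

variable {V E : Type*} (Γ : OGraph V E)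

/-- The starting vertex of a directed edge. -/
def start (d : Dart E) : V := if d.2 then Γ.src d.1 else Γ.tgt d.1

/-- The terminal vertex of a directed edge. -/
def final (d : Dart E) : V := if d.2 then Γ.tgt d.1 else Γ.src d.1

theorem start_inv (d : Dart E) : Γ.start d.inv = Γ.final d := by
  rcases d with ⟨e, _ | _⟩ <;> rfl

theorem final_inv (d : Dart E) : Γ.final d.inv = Γ.start d := by
  rcases d with ⟨e, _ | _⟩ <;> rfl

/-! ### Loops and cycles -/

/-- `(e₁, …, eₙ)`, `n ≥ 1`, is a simple loop: `t(eᵢ) = s(eᵢ₊₁)` and `t(eₙ) = s(e₁)`, and every edge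
of the graph enters at most once (in one of its two directions). -/
def IsSimpleLoop (l : List (Dart E)) : Prop :=
  l ≠ [] ∧ l.map Γ.final = (l.map Γ.start).rotate 1 ∧ (l.map Prod.fst).Nodup

/-- Two simple loops are the same when they differ by the choice of the first edge and of the
direction of traversal. -/
def loopSetoid : Setoid {l : List (Dart E) // Γ.IsSimpleLoop l} where
  r l l' := l.1.IsRotated l'.1 ∨ l.1.IsRotated (revPath l'.1)
  iseqv :=
    { refl := fun l => Or.inl (List.IsRotated.refl _)
      symm := by
        rintro l l' (h | h)
        · exact Or.inl h.symm
        · refine Or.inr ?_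
          have := (revPath_isRotated h).symm
          rwa [revPath_revPath] at this
      trans := by
        rintro l l' l'' (h | h) (h' | h')
        · exact Or.inl (h.trans h')
        · exact Or.inr (h.trans h')
        · exact Or.inr (h.trans (revPath_isRotated h'))
        · refine Or.inl (h.trans ?_)
          have := revPath_isRotated h'
          rwa [revPath_revPath] at this }

/-- The simple loops of the graph. -/
def Loop : Type _ := Quotient Γ.loopSetoid

theorem map_final_perm {l : List (Dart E)} (h : Γ.IsSimpleLoop l) :
    (l.map Γ.final).Perm (l.map Γ.start) := by
  rw [h.2.1]; exact List.rotate_perm _ 1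

instance [Finite E] : Finite Γ.Loop := by
  classical
  have := Fintype.ofFinite E
  have : Finite {l : List (Dart E) // Γ.IsSimpleLoop l} :=
    Finite.of_injective
      (β := {l : List (Dart E) // l.Nodup})
      (fun l => ⟨l.1, List.Nodup.of_map _ l.2.2.2⟩)
      (fun l l' h => Subtype.ext (Subtype.mk.inj h))
  exact Quotient.finite _

noncomputable instance [Finite E] : Fintype Γ.Loop := Fintype.ofFinite _

namespace Loop

variable {Γ}

/-- The (unoriented) edges of a simple loop. -/
def edges (ℓ : Γ.Loop) : Set E :=
  Quotient.lift (s := Γ.loopSetoid) (fun l => {e | ∃ d ∈ l.1, d.1 = e}) (by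
    rintro l l' (h | h)
    · ext e; simp [h.mem_iff]
    · ext e; simp [h.mem_iff, revPath, Dart.inv, or_comm]) ℓ

/-- The vertices that a simple loop traverses. -/
def verts (ℓ : Γ.Loop) : Set V :=
  Quotient.lift (s := Γ.loopSetoid) (fun l => {v | ∃ d ∈ l.1, Γ.start d = v}) (by
    rintro l l' (h | h)
    · ext v; simp only [Set.mem_ofPred_eq, h.mem_iff]
    · ext v
      have hp : v ∈ l'.1.map Γ.final ↔ v ∈ l'.1.map Γ.start := (Γ.map_final_perm l'.2).mem_iff
      simp only [List.mem_map] at hp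
      simp only [Set.mem_ofPred_eq, h.mem_iff, ← hp, revPath, List.mem_reverse, List.mem_map]
      constructor
      · rintro ⟨_, ⟨a, ha, rfl⟩, rfl⟩
        exact ⟨a, ha, (Γ.start_inv a).symm⟩
      · rintro ⟨a, ha, rfl⟩
        exact ⟨_, ⟨a, ha, rfl⟩, Γ.start_inv a⟩) ℓ

/-- A non-trivial cycle: a simple loop that traverses each vertex at most once,
`s(eᵢ) ≠ s(eⱼ)` for `i ≠ j`. -/
def IsCycle (ℓ : Γ.Loop) : Prop :=
  Quotient.lift (s := Γ.loopSetoid) (fun l => (l.1.map Γ.start).Nodup) (by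
    rintro l l' (h | h)
    · exact propext (h.perm.map _).nodup_iff
    · refine propext ((h.perm.map _).nodup_iff.trans ?_)
      rw [← (Γ.map_final_perm l'.2).nodup_iff, revPath, List.map_reverse, List.nodup_reverse,
        List.map_map]
      have : Γ.start ∘ Dart.inv = Γ.final := funext Γ.start_inv
      rw [this]) ℓ

/-- The amplitude `A_ℓ(τ) = -(-1)^{|e|} τ_{e₁⁻¹ e₂} ⋯ τ_{eₙ⁻¹ e₁}` of a simple loop. -/
def amp (T : Param E) (ℓ : Γ.Loop) : ℂ :=
  Quotient.lift (s := Γ.loopSetoid) (fun l => pathAmp T l.1) (by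
    rintro l l' (h | h)
    · exact pathAmp_rotated T h
    · exact (pathAmp_rotated T h).trans (pathAmp_revPath T _)) ℓ

end Loop

open scoped Classical in
/-- The non-empty collections of simple loops no two of which have an edge in common. -/
noncomputable def loopUnions [Finite E] : Finset (Finset Γ.Loop) :=
  {L | L.Nonempty ∧ (L : Set Γ.Loop).PairwiseDisjoint Loop.edges}

open scoped Classical in
/-- The disjoint cycle unions: non-empty collections of non-trivial cycles no two of which have an
edge or a vertex in common. -/
noncomputable def cycleUnions [Finite E] : Finset (Finset Γ.Loop) :=
  {C | C.Nonempty ∧ (∀ c ∈ C, c.IsCycle) ∧ (C : Set Γ.Loop).PairwiseDisjoint Loop.edges ∧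
    (C : Set Γ.Loop).PairwiseDisjoint Loop.verts}

/-- The amplitude `A_L(τ) = ∏_{ℓ ∈ L} A_ℓ(τ)` of a collection of simple loops. -/
noncomputable def unionAmp (T : Param E) (L : Finset Γ.Loop) : ℂ := ∏ ℓ ∈ L, ℓ.amp T

/-- `1 + ∑_C A_C(z)`, the sum over all disjoint cycle unions; for a cycle `c = (e₁, …, eₙ)`,
`A_c(z) = -(-1)^{|e|} [z_{e₁⁻¹}|z_{e₂}⟩ ⋯ [z_{eₙ⁻¹}|z_{e₁}⟩`. -/
noncomputable def cycleSum [Finite E] (z : Dart E → Spinor) : ℂ :=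
  1 + ∑ C ∈ Γ.cycleUnions, Γ.unionAmp (spinorParam z) C

/-- The Plücker relations at every vertex. -/
def IsPlucker (T : Param E) : Prop :=
  ∀ a b c d : Dart E, Γ.start a = Γ.start b → Γ.start a = Γ.start c → Γ.start a = Γ.start d →
    T.τ a b * T.τ c d + T.τ a c * T.τ d b + T.τ a d * T.τ b c = 0

/-! ### The generating functional `𝒢_Γ(τ)` -/

/-- The argument that a directed edge supplies to the functional at its starting vertex: `w_e` if
the edge is outgoing and `|w_e]` if it is incoming. -/
def legSpinor (w : E → Spinor) (d : Dart E) : Spinor :=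
  if d.2 then w d.1 else conjSpinor (w d.1)

open scoped Classical in
/-- The functional `exp (∑_{i<j} τ_{ij} [w_i|w_j⟩)` at the vertex `v`, over the legs `i`, `j` that
start at `v`. Both factors are skew, so the sum over `i < j`, in whatever order, is half of the sum
over all pairs. -/
noncomputable def vertexFun [Fintype E] (T : Param E) (w : E → Spinor) (v : V) : ℂ :=
  Complex.exp (1 / 2 * ∑ a : Dart E with Γ.start a = v, ∑ b : Dart E with Γ.start b = v,
    T.τ a b * bracket (legSpinor w a) (legSpinor w b))

/-- The product over the vertices of the functionals at the vertices. -/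
noncomputable def genIntegrand [Fintype V] [Fintype E] (T : Param E) (w : E → Spinor) : ℂ :=
  ∏ v : V, Γ.vertexFun T w v

/-- `𝒢_Γ(τ) = ∫ ∏_e dμ(w_e) ∏_v 𝒞^{(v)}_τ(w)`. -/
noncomputable def genFun [Fintype V] [Fintype E] (T : Param E) : ℂ :=
  ∫ w, Γ.genIntegrand T w ∂(Measure.pi fun _ : E => bargmann)

/-! ### The coherent amplitude `𝒜_Γ(z)` -/

/-- `A_Γ(j, z) = ∫ ∏_v dg_v ∏_e [z_e| g_{s(e)} g_{t(e)}⁻¹ |z_{e⁻¹}⟩^{2 j_e} / (2 j_e)!`, where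
`n e = 2 j_e`. -/
noncomputable def spinAmp [Fintype V] [Fintype E] (n : E → ℕ) (z : Dart E → Spinor) : ℂ :=
  ∫ g : V → SU2, ∏ e : E,
    bracket (z (e, true))
      ((g (Γ.src e) * (g (Γ.tgt e))⁻¹ : SU2).1.mulVec (z (e, false))) ^ n e / ((n e).factorial : ℂ)
    ∂(Measure.pi fun _ : V => haarSU2)

open scoped Classical in
/-- The sum of the spins at a vertex, `J_v = ∑_{s(e)=v} j_e + ∑_{t(e)=v} j_e`, with `n e = 2 j_e`. -/
noncomputable def vertexSpin [Fintype E] (n : E → ℕ) (v : V) : ℝ :=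
  ∑ e : E with Γ.src e = v, (n e : ℝ) / 2 + ∑ e : E with Γ.tgt e = v, (n e : ℝ) / 2

/-- The summand `∏_v (J_v + 1)! · A_Γ(j, z)`, where `(J + 1)! = Γ(J + 2)`; when some `J_v` is not an
integer, the amplitude `A_Γ(j, z)` vanishes. -/
noncomputable def cohTerm [Fintype V] [Fintype E] (z : Dart E → Spinor) (n : E → ℕ) : ℂ :=
  (∏ v : V, (Real.Gamma (Γ.vertexSpin n v + 2) : ℂ)) * Γ.spinAmp n z

/-- `𝒜_Γ(z) = ∑_j ∏_v (J_v + 1)! · A_Γ(j, z)`, the sum over all spins `j_e ∈ {0, 1/2, 1, …}`. -/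
noncomputable def cohAmp [Fintype V] [Fintype E] (z : Dart E → Spinor) : ℂ :=
  ∑' n : E → ℕ, Γ.cohTerm z n

end OGraph

end SpinNetwork

open SpinNetwork

/-! Everything is compared with one determinant. Let `τ` be the skew matrix of the parameters on
directed edges, set to zero between different starting vertices, and let `J_S` be the skew form that
pairs the two directions of each edge of `S`.

Loops. For every skew `τ` the sum `F(S)` over collections of edge-disjoint simple loops in `S` is a
Pfaffian: `F(S)² = det(1 - τ J_S)`. Adding an edge `e` multiplies the determinant by `(1 + M(e⁻¹,
e))²`, where `M = (1 - τ J_S)⁻¹ τ`. It adds to `F(S)` the sum over paths in `S` from `e⁻¹` back to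
`e`, each weighted with `F` of the unused edges, and this sum is `F(S) M(e⁻¹, e)`. The lemmas are
`loopSum_insert`, `sq_eq_det_of_path_expansion` and `loopSum_sq`.

Collapse to cycles. For spinor parameters `τ` factors through a space with two dimensions per
vertex. If the parameters at `v` are multiplied by a variable `t_v`, the determinant has degree at
most two in `t_v`, so its square root, the loop sum, has degree at most one. The degree of a
collection in `t_v` is the number of its visits to `v`; hence the collections that visit some vertex
twice cancel in total (`degreeOf_loopPoly_le`, `loopSum_spinorParam`). The Plücker cancellation
`resolutions_cancel` is proved separately, and this argument does not need it.

The integral. The generating functional is a Gaussian integral with coupling `τ`. Integrating out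
one edge at a time by Fubini gives `1 / det(1 - τ J)` wherever the integral converges absolutely
(`integral_exp_coupling`).

The sum over spins. The number `Γ(J_v + 2)` is the Gaussian moment of `|u|^(2 J_v)`, and the matrix
with rows `u` and `|u]` is `|u|` times an element of `SU(2)`. So each term of the sum is a Gaussian
integral over one spinor per vertex (`cohTerm_eq_integral`). For small spinors sum and integral may
be exchanged, which gives a Gaussian on the vertices; its determinant is the one on the edges by
Sylvester's identity (`det_localMatrix_eq_vertexMatrix`). Larger spinors are reached by scaling `z`
to `c • z` and the identity theorem in `c` (`cohAmp_mul_det`). -/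

namespace SpinNetwork

/-! ### Skew forms on directed edges, resolvents and the Pfaffian recursion. -/

section EdgeForm

variable {E : Type*}

/-- `-1` for an edge traversed along its orientation and `1` otherwise. -/
def dartSign (d : Dart E) : ℂ := if d.2 then -1 else 1

variable [DecidableEq E]

/-- The skew form that pairs the two directions of every edge of `S`. -/
def edgeForm (S : Finset E) : Matrix (Dart E) (Dart E) ℂ :=
  Matrix.of fun a b => if a.1 ∈ S ∧ b = a.inv then dartSign a else 0

theorem edgeForm_transpose (S : Finset E) : (edgeForm S).transpose = -edgeForm S := by
  ext ⟨a, s⟩ ⟨b, t⟩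
  by_cases h : a = b
  · subst h
    cases s <;> cases t <;> simp [edgeForm, Dart.inv, dartSign] <;> split_ifs <;> simp
  · have h' : ¬ b = a := fun h'' => h h''.symm
    simp [edgeForm, Dart.inv, h, h']

theorem edgeForm_insert {e : E} {S : Finset E} (he : e ∉ S) :
    edgeForm (insert e S) = edgeForm S + edgeForm {e} := by
  ext a b
  by_cases h : a.1 = e
  · simp [edgeForm, h, he]
  · simp [edgeForm, h]

variable [Fintype E]

theorem edgeForm_mul_apply {n : Type*} (S : Finset E) (M : Matrix (Dart E) n ℂ) (a : Dart E)
    (b : n) : (edgeForm S * M) a b = if a.1 ∈ S then dartSign a * M a.inv b else 0 := by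
  simp only [Matrix.mul_apply, edgeForm, Matrix.of_apply]
  by_cases h : a.1 ∈ S <;> simp [h]

theorem mul_edgeForm_mul_singleton (A B : Matrix (Dart E) (Dart E) ℂ) (e : E) (a b : Dart E) :
    (A * edgeForm {e} * B) a b =
      -(A a (e, true) * B (e, false) b) + A a (e, false) * B (e, true) b := by
  rw [Matrix.mul_assoc, Matrix.mul_apply, Fintype.sum_prod_type,
    Finset.sum_eq_single e (fun c _ hc => by simp [edgeForm_mul_apply, hc]) (by simp)]
  simp [edgeForm_mul_apply, dartSign, Dart.inv]

theorem skew_apply {n : Type*} {M : Matrix n n ℂ} (hM : M.transpose = -M) (a b : n) :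
    M b a = -M a b := by
  simpa using congrFun (congrFun hM a) b

theorem skew_self {n : Type*} {M : Matrix n n ℂ} (hM : M.transpose = -M) (a : n) :
    M a a = 0 := by
  have h := skew_apply hM a a
  linear_combination h / 2

/-- The form of a single edge has rank two, so Sylvester's identity leaves a `2 × 2` determinant.
Skewness of `M` kills its off-diagonal entries and makes the two diagonal ones equal, whence the
perfect square. -/
theorem det_one_sub_mul_edgeForm_singleton {M : Matrix (Dart E) (Dart E) ℂ}
    (hM : M.transpose = -M) (e : E) :
    (1 - M * edgeForm {e}).det = (1 + M (e, false) (e, true)) ^ 2 := by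
  let U : Matrix (Dart E) Bool ℂ := Matrix.of fun a i => if a = (e, i) then 1 else 0
  let W : Matrix Bool (Dart E) ℂ :=
    Matrix.of fun i b => if b = (e, !i) then (if i then -1 else 1) else 0
  have hUW : edgeForm {e} = U * W := by
    ext ⟨a, s⟩ b
    by_cases ha : a = e
    · subst ha
      cases s <;> simp [edgeForm, U, W, Matrix.mul_apply, Dart.inv, dartSign]
    · simp [edgeForm, U, W, Matrix.mul_apply, ha]
  have h2 : ∀ i j, (W * (M * U)) i j = (if i then -1 else 1) * M (e, !i) (e, j) := by
    intro i j
    simp [W, U, Matrix.mul_apply]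
  rw [hUW, ← Matrix.mul_assoc, Matrix.det_one_sub_mul_comm,
    ← Matrix.det_submatrix_equiv_self finTwoEquiv, Matrix.det_fin_two]
  simp only [Matrix.submatrix_apply, Matrix.sub_apply, h2, show finTwoEquiv 0 = false from rfl,
    show finTwoEquiv 1 = true from rfl, Matrix.one_apply]
  simp [skew_self hM, skew_apply hM (e, false) (e, true)]
  ring

/-- The resolvent of a skew matrix is skew. -/
theorem resolvent_skew {τ M : Matrix (Dart E) (Dart E) ℂ} (hτ : τ.transpose = -τ) {S : Finset E}
    (hdet : (1 - τ * edgeForm S).det ≠ 0) (hM : (1 - τ * edgeForm S) * M = τ) :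
    M.transpose = -M := by
  have hu : IsUnit (1 - τ * edgeForm S).det := isUnit_iff_ne_zero.mpr hdet
  have h1 : M.transpose * (1 - edgeForm S * τ) = -τ := by
    have := congrArg Matrix.transpose hM
    rw [Matrix.transpose_mul, Matrix.transpose_sub, Matrix.transpose_mul, hτ,
      edgeForm_transpose] at this
    simpa using this
  -- The resolvent is also `τ (1 - Jτ)⁻¹`, and transposing `(1 - τJ)⁻¹ τ` gives minus this.
  have h2 : τ * (1 - edgeForm S * τ) = (1 - τ * edgeForm S) * τ := by
    rw [mul_sub, sub_mul, mul_one, one_mul, Matrix.mul_assoc]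
  have hdet' : IsUnit (1 - edgeForm S * τ).det := by
    rwa [Matrix.det_one_sub_mul_comm]
  have h3 : M * (1 - edgeForm S * τ) = τ := by
    have : (1 - τ * edgeForm S) * (M * (1 - edgeForm S * τ)) = (1 - τ * edgeForm S) * τ := by
      rw [← Matrix.mul_assoc, hM, h2]
    have h4 := congrArg (fun Z => (1 - τ * edgeForm S)⁻¹ * Z) this
    simpa only [Matrix.nonsing_inv_mul_cancel_left _ _ hu] using h4
  have h4 : (M.transpose + M) * (1 - edgeForm S * τ) = 0 := by
    rw [add_mul, h1, h3]; simp
  have h5 := congrArg (fun Z => Z * (1 - edgeForm S * τ)⁻¹) h4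
  simp only [Matrix.mul_nonsing_inv_cancel_right _ _ hdet', Matrix.zero_mul] at h5
  exact eq_neg_of_add_eq_zero_left h5

theorem one_sub_mul_edgeForm_insert {τ M : Matrix (Dart E) (Dart E) ℂ} {e : E} {S : Finset E}
    (he : e ∉ S) (hM : (1 - τ * edgeForm S) * M = τ) :
    1 - τ * edgeForm (insert e S) = (1 - τ * edgeForm S) * (1 - M * edgeForm {e}) := by
  rw [edgeForm_insert he, mul_sub, ← Matrix.mul_assoc (1 - τ * edgeForm S), hM]
  noncomm_ring

/-- Adding one edge to the resolvent. -/
theorem resolvent_insert {τ M M' : Matrix (Dart E) (Dart E) ℂ} {e : E} {S : Finset E}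
    (he : e ∉ S) (hdet : (1 - τ * edgeForm S).det ≠ 0) (hM : (1 - τ * edgeForm S) * M = τ)
    (hM' : (1 - τ * edgeForm (insert e S)) * M' = τ) (a b : Dart E) :
    M' a b = M a b + (-(M a (e, true) * M' (e, false) b) + M a (e, false) * M' (e, true) b) := by
  have hu : IsUnit (1 - τ * edgeForm S).det := isUnit_iff_ne_zero.mpr hdet
  rw [one_sub_mul_edgeForm_insert he hM, Matrix.mul_assoc] at hM'
  have h := congrArg (fun Z => (1 - τ * edgeForm S)⁻¹ * Z) (hM'.trans hM.symm)
  simp only [Matrix.nonsing_inv_mul_cancel_left _ _ hu] at h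
  rw [← mul_edgeForm_mul_singleton, ← Matrix.add_apply]
  have h' : M' = M + M * edgeForm {e} * M' := by
    rw [sub_mul, one_mul] at h
    rw [← sub_eq_iff_eq_add]; exact h
  exact congrFun (congrFun h' a) b

/-- In the rows of the new edge the two unknowns of `resolvent_insert` decouple, because the
diagonal entries of the skew `M` vanish. -/
theorem resolvent_insert_mul {τ M M' : Matrix (Dart E) (Dart E) ℂ} (hτ : τ.transpose = -τ)
    {e : E} {S : Finset E}
    (he : e ∉ S) (hdet : (1 - τ * edgeForm S).det ≠ 0) (hM : (1 - τ * edgeForm S) * M = τ)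
    (hM' : (1 - τ * edgeForm (insert e S)) * M' = τ) (s : Bool) (b : Dart E) :
    (1 + M (e, false) (e, true)) * M' (e, s) b = M (e, s) b := by
  have hsk := resolvent_skew hτ hdet hM
  have h := resolvent_insert he hdet hM hM' (e, s) b
  have h1 := skew_apply hsk (e, false) (e, true)
  cases s
  · rw [skew_self hsk (e, false)] at h
    linear_combination h
  · rw [skew_self hsk (e, true)] at h
    rw [h1] at h
    linear_combination h

/-- A function of sets of edges that satisfies the path expansion of a Pfaffian is a square root of
the determinant. -/
theorem sq_eq_det_of_path_expansion {τ : Matrix (Dart E) (Dart E) ℂ} (hτ : τ.transpose = -τ)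
    (hdet : ∀ S : Finset E, (1 - τ * edgeForm S).det ≠ 0)
    (F : Finset E → ℂ) (X : Finset E → Dart E → Dart E → ℂ) (F_empty : F ∅ = 1)
    (F_insert : ∀ e S, e ∉ S → F (insert e S) = F S + X S (e, false) (e, true))
    (X_eq : ∀ S a b, X S a b = τ a b * F S +
      ∑ c : Dart E with c.1 ∈ S, dartSign c * τ a c * X (S.erase c.1) c.inv b) (S : Finset E) :
    F S ^ 2 = (1 - τ * edgeForm S).det ∧
      ∀ M, (1 - τ * edgeForm S) * M = τ → ∀ a b, X S a b = F S * M a b := by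
  have hex : ∀ S : Finset E, ∃ M, (1 - τ * edgeForm S) * M = τ := fun S =>
    ⟨(1 - τ * edgeForm S)⁻¹ * τ,
      Matrix.mul_nonsing_inv_cancel_left _ _ (isUnit_iff_ne_zero.mpr (hdet S))⟩
  -- The two claims are proved together: the square needs `X = F · M` on smaller sets to see which
  -- factor `F` gains with an edge.
  induction S using Finset.strongInduction with
  | H S ih =>
    have hF : ∀ e ∈ S, ∀ M, (1 - τ * edgeForm (S.erase e)) * M = τ →
        F S = F (S.erase e) * (1 + M (e, false) (e, true)) := by
      intro e he M hM
      have := F_insert e (S.erase e) (Finset.notMem_erase e S)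
      rw [Finset.insert_erase he, (ih _ (Finset.erase_ssubset he)).2 M hM] at this
      rw [this]; ring
    constructor
    · rcases S.eq_empty_or_nonempty with rfl | ⟨e, he⟩
      · have : edgeForm (∅ : Finset E) = 0 := by ext; simp [edgeForm]
        simp [F_empty, this]
      · obtain ⟨M, hM⟩ := hex (S.erase e)
        have h1 := one_sub_mul_edgeForm_insert (Finset.notMem_erase e S) hM
        rw [Finset.insert_erase he] at h1
        rw [h1, Matrix.det_mul, det_one_sub_mul_edgeForm_singleton
          (resolvent_skew hτ (hdet _) hM), hF e he M hM, mul_pow,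
          (ih _ (Finset.erase_ssubset he)).1]
    · intro M' hM' a b
      -- The resolvent equation `M' = τ + τ J M'` is matched with the path expansion term by term.
      -- Under the removal of the edge of `c`, the factor by which `F` shrinks is exactly the one
      -- that turns the row of `M'` at `c⁻¹` into that of the smaller resolvent.
      have h1 : M' = τ + τ * (edgeForm S * M') := by
        rw [sub_mul, one_mul, Matrix.mul_assoc] at hM'
        rw [← sub_eq_iff_eq_add]; exact hM'
      rw [X_eq]
      conv_rhs => rw [h1]
      rw [Matrix.add_apply, mul_add, mul_comm (F S), Matrix.mul_apply, Finset.mul_sum,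
        Finset.sum_filter]
      congr 1
      refine Finset.sum_congr rfl fun c _ => ?_
      rw [edgeForm_mul_apply]
      split_ifs with hc
      · obtain ⟨M, hM⟩ := hex (S.erase c.1)
        rw [(ih _ (Finset.erase_ssubset hc)).2 M hM, hF c.1 hc M hM]
        have hM'' := hM'
        rw [← Finset.insert_erase hc] at hM''
        have := resolvent_insert_mul hτ (Finset.notMem_erase c.1 S) (hdet _) hM hM'' (!c.2) b
        have h3 : c.inv = (c.1, !c.2) := rfl
        rw [h3, ← this]; ring
      · simp

end EdgeForm

end SpinNetwork

namespace SpinNetwork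

/-! ### Weighted paths of directed edges. -/

section Paths

variable {E : Type*}

/-- The weight of a path from `x` through the directed edges of a list to `y`. -/
def chain (τ : Matrix (Dart E) (Dart E) ℂ) : Dart E → List (Dart E) → Dart E → ℂ
  | x, [], y => τ x y
  | x, c :: p, y => dartSign c * τ x c * chain τ c.inv p y

variable [Fintype E]

/-- The sequences of directed edges that use every edge of `S` at most once and no other edge. -/
noncomputable def paths (S : Finset E) : Finset (List (Dart E)) :=
  Set.Finite.toFinset (s := {p | (p.map Prod.fst).Nodup ∧ ∀ d ∈ p, d.1 ∈ S}) (by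
    classical
    have : Finite {l : List (Dart E) // l.Nodup} := inferInstance
    have h : {l : List (Dart E) | l.Nodup}.Finite := this
    exact h.subset fun p hp => List.Nodup.of_map _ hp.1)

theorem mem_paths {S : Finset E} {p : List (Dart E)} :
    p ∈ paths S ↔ (p.map Prod.fst).Nodup ∧ ∀ d ∈ p, d.1 ∈ S := by
  simp [paths]

variable [DecidableEq E]

theorem sum_paths (S : Finset E) (f : List (Dart E) → ℂ) :
    ∑ p ∈ paths S, f p =
      f [] + ∑ c : Dart E with c.1 ∈ S, ∑ p ∈ paths (S.erase c.1), f (c :: p) := by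
  classical
  have h : paths S = insert [] ((Finset.univ.filter fun c : Dart E => c.1 ∈ S).biUnion
      fun c => (paths (S.erase c.1)).image (List.cons c)) := by
    ext p
    rcases p with _ | ⟨c, p⟩
    · simp [mem_paths]
    · simp only [mem_paths, List.map_cons, List.nodup_cons, List.mem_cons, forall_eq_or_imp,
        Finset.mem_insert, reduceCtorEq, Finset.mem_biUnion, Finset.mem_filter, Finset.mem_univ,
        true_and, Finset.mem_image, List.cons.injEq, false_or, Finset.mem_erase, List.mem_map,
        not_exists, not_and]
      constructor
      · rintro ⟨⟨h1, h2⟩, h3, h4⟩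
        exact ⟨c, h3, p, ⟨h2, fun d hd => ⟨h1 d hd, h4 d hd⟩⟩, rfl, rfl⟩
      · rintro ⟨c, h3, p, ⟨h2, h5⟩, rfl, rfl⟩
        exact ⟨⟨fun d hd => (h5 d hd).1, h2⟩, h3, fun d hd => (h5 d hd).2⟩
  rw [h, Finset.sum_insert (by simp), Finset.sum_biUnion]
  · congr 1
    refine Finset.sum_congr rfl fun c _ => ?_
    rw [Finset.sum_image]
    intro p _ q _ hpq
    simpa using hpq
  · intro c _ d _ hcd
    rw [Function.onFun, Finset.disjoint_left]
    rintro p hp hq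
    obtain ⟨p', _, rfl⟩ := Finset.mem_image.mp hp
    obtain ⟨q', _, hq'⟩ := Finset.mem_image.mp hq
    exact hcd (by simp at hq'; exact hq'.1.symm)

/-- The sum over the paths in `S`, every path weighted with the value of `F` on the unused edges. -/
noncomputable def pathSum (τ : Matrix (Dart E) (Dart E) ℂ) (F : Finset E → ℂ) (S : Finset E)
    (a b : Dart E) : ℂ :=
  ∑ p ∈ paths S, chain τ a p b * F (S \ (p.map Prod.fst).toFinset)

/-- Splitting off the first directed edge of a path gives the recursion that
`sq_eq_det_of_path_expansion` requires of `X`. -/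
theorem pathSum_eq (τ : Matrix (Dart E) (Dart E) ℂ) (F : Finset E → ℂ) (S : Finset E)
    (a b : Dart E) :
    pathSum τ F S a b = τ a b * F S +
      ∑ c : Dart E with c.1 ∈ S, dartSign c * τ a c * pathSum τ F (S.erase c.1) c.inv b := by
  rw [pathSum, sum_paths]
  congr 1
  · simp [chain]
  · refine Finset.sum_congr rfl fun c _ => ?_
    rw [pathSum, Finset.mul_sum]
    refine Finset.sum_congr rfl fun p _ => ?_
    have : S \ ((c :: p).map Prod.fst).toFinset =
        S.erase c.1 \ (p.map Prod.fst).toFinset := by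
      ext x; simp; tauto
    rw [chain, this]; ring

end Paths

namespace OGraph

variable {V E : Type*} (Γ : OGraph V E)

open scoped Classical in
/-- The parameters of directed edges with the same starting vertex, extended by zero. -/
noncomputable def localMatrix (T : Param E) : Matrix (Dart E) (Dart E) ℂ :=
  Matrix.of fun a b => if Γ.start a = Γ.start b then T.τ a b else 0

theorem localMatrix_transpose (T : Param E) :
    (Γ.localMatrix T).transpose = -Γ.localMatrix T := by
  ext a b
  by_cases h : Γ.start a = Γ.start b
  · simp [localMatrix, h, T.skew a b]
  · have h' : ¬ Γ.start b = Γ.start a := fun h' => h h'.symm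
    simp [localMatrix, h, h']

theorem chain_localMatrix (T : Param E) (p : List (Dart E)) (a y : Dart E)
    (h : (a :: p).map Γ.final = p.map Γ.start ++ [Γ.start y]) :
    chain (Γ.localMatrix T) a.inv p y = (-1) ^ (p.countP fun d => d.2) *
      (List.zipWith (fun a b => T.τ a.inv b) (a :: p) (p ++ [y])).prod := by
  induction p generalizing a with
  | nil =>
    have h' : Γ.start a.inv = Γ.start y := by simpa [Γ.start_inv] using h
    simp [chain, localMatrix, h']
  | cons c p ih =>
    simp only [List.map_cons, List.cons_append, List.cons.injEq] at h
    have h' : Γ.start a.inv = Γ.start c := by rw [Γ.start_inv]; exact h.1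
    rw [chain, ih c h.2]
    rcases c with ⟨e, _ | _⟩
    · simp [localMatrix, dartSign, h']; ring
    · simp [localMatrix, dartSign, h', pow_succ]; ring

theorem map_final_of_chain_ne_zero (T : Param E) (p : List (Dart E)) (a y : Dart E)
    (h : chain (Γ.localMatrix T) a.inv p y ≠ 0) :
    (a :: p).map Γ.final = p.map Γ.start ++ [Γ.start y] := by
  induction p generalizing a with
  | nil =>
    by_contra h'
    have h'' : ¬ Γ.start a.inv = Γ.start y := by simpa [Γ.start_inv] using h'
    simp [chain, localMatrix, h''] at h
  | cons c p ih =>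
    rw [chain] at h
    have h1 := ih c (right_ne_zero_of_mul h)
    have h2 : Γ.start a.inv = Γ.start c := by
      by_contra h'
      simp [localMatrix, h'] at h
    rw [List.map_cons, h1, ← Γ.start_inv, h2]
    rfl

/-- The leading minus sign of the amplitude is absorbed by the first edge, which is traversed along
its orientation; the signs of the other edges are those in `chain`. -/
theorem pathAmp_cons_eq_chain (T : Param E) {e : E} {p : List (Dart E)}
    (h : Γ.IsSimpleLoop ((e, true) :: p)) :
    pathAmp T ((e, true) :: p) = chain (Γ.localMatrix T) (e, false) p (e, true) := by
  have h1 := Γ.chain_localMatrix T p (e, true) (e, true) (by simpa using h.2.1)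
  have h2 : (e, false) = Dart.inv ((e, true) : Dart E) := rfl
  rw [h2, h1, pathAmp]
  simp [pow_succ]

theorem isSimpleLoop_cons_of_chain_ne_zero (T : Param E) {e : E} {p : List (Dart E)}
    (hp : (p.map Prod.fst).Nodup) (he : ∀ d ∈ p, d.1 ≠ e)
    (h : chain (Γ.localMatrix T) (e, false) p (e, true) ≠ 0) :
    Γ.IsSimpleLoop ((e, true) :: p) := by
  have h2 : (e, false) = Dart.inv ((e, true) : Dart E) := rfl
  rw [h2] at h
  have h1 := Γ.map_final_of_chain_ne_zero T p _ _ h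
  refine ⟨by simp, by simpa using h1, ?_⟩
  rw [List.map_cons, List.nodup_cons]
  refine ⟨?_, hp⟩
  simp only [List.mem_map, not_exists, not_and]
  exact he

theorem isSimpleLoop_of_isRotated {l l' : List (Dart E)} (h : l.IsRotated l')
    (hl : Γ.IsSimpleLoop l) : Γ.IsSimpleLoop l' := by
  obtain ⟨n, rfl⟩ := h
  refine ⟨by simpa using hl.1, ?_, ?_⟩
  · rw [List.map_rotate, hl.2.1, List.map_rotate, List.rotate_rotate, List.rotate_rotate, add_comm]
  · rw [List.map_rotate, List.nodup_rotate]; exact hl.2.2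

theorem isSimpleLoop_revPath {l : List (Dart E)} (hl : Γ.IsSimpleLoop l) :
    Γ.IsSimpleLoop (revPath l) := by
  have hs : Γ.start ∘ Dart.inv = Γ.final := funext Γ.start_inv
  have hf : Γ.final ∘ Dart.inv = Γ.start := funext Γ.final_inv
  have hi : Prod.fst ∘ Dart.inv = (Prod.fst : Dart E → E) := rfl
  refine ⟨by simpa [revPath] using hl.1, ?_, ?_⟩
  · rw [revPath, List.map_reverse, List.map_map, hf, List.map_reverse, List.map_map, hs, hl.2.1,
      List.rotate_reverse, List.rotate_rotate]
    rcases l with _ | ⟨a, l⟩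
    · exact absurd rfl hl.1
    · congr 1
      symm
      rw [← List.rotate_mod]
      rcases l with _ | ⟨b, l⟩
      · simp
      · have h1 : 1 % (l.length + 1 + 1) = 1 := Nat.mod_eq_of_lt (by omega)
        have h2 : 1 + (l.length + 1) = l.length + 1 + 1 := by omega
        simp [h1, h2]
  · rw [revPath, List.map_reverse, List.nodup_reverse, List.map_map, hi]; exact hl.2.2

/-- With `Loop.rep_injective` this makes loops through `e` correspond to paths `p`: rotation brings
`e` to the front, and reversal fixes its direction. -/
theorem Loop.exists_rep {e : E} (ℓ : Γ.Loop) (he : e ∈ ℓ.edges) :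
    ∃ p, ∃ h : Γ.IsSimpleLoop ((e, true) :: p), ℓ = Quotient.mk Γ.loopSetoid ⟨_, h⟩ := by
  have key : ∀ l (hl : Γ.IsSimpleLoop l), (e, true) ∈ l →
      ∃ p, ∃ h : Γ.IsSimpleLoop ((e, true) :: p),
        Quotient.mk Γ.loopSetoid ⟨l, hl⟩ = Quotient.mk Γ.loopSetoid ⟨_, h⟩ := by
    intro l hl hm
    obtain ⟨s, t, rfl⟩ := List.append_of_mem hm
    have hr : (s ++ (e, true) :: t).IsRotated ((e, true) :: t ++ s) := List.isRotated_append
    exact ⟨t ++ s, Γ.isSimpleLoop_of_isRotated hr hl, Quotient.sound (s := Γ.loopSetoid) (Or.inl hr)⟩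
  induction ℓ using Quotient.inductionOn with
  | h l =>
    obtain ⟨l, hl⟩ := l
    obtain ⟨⟨e', s⟩, hd, rfl⟩ := he
    cases s
    · obtain ⟨p, h, hp⟩ := key (revPath l) (Γ.isSimpleLoop_revPath hl) (by
        simp only [revPath, List.mem_reverse, List.mem_map]
        exact ⟨_, hd, rfl⟩)
      refine ⟨p, h, ?_⟩
      rw [← hp]
      exact Quotient.sound (s := Γ.loopSetoid)
        (Or.inr (by rw [revPath_revPath]))
    · exact key l hl hd

theorem Loop.rep_injective {e : E} {p q : List (Dart E)} (hp : Γ.IsSimpleLoop ((e, true) :: p))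
    (hq : Γ.IsSimpleLoop ((e, true) :: q))
    (h : Quotient.mk Γ.loopSetoid ⟨_, hp⟩ = Quotient.mk Γ.loopSetoid ⟨_, hq⟩) : p = q := by
  rcases Quotient.exact (s := Γ.loopSetoid) h with h | h
  · change ((e, true) :: p).IsRotated ((e, true) :: q) at h
    obtain ⟨n, hn⟩ := h
    have hnd : ((e, true) :: p).Nodup := List.Nodup.of_map _ hp.2.2
    have hn' : ((e, true) :: p).rotate (n % ((e, true) :: p).length) = (e, true) :: q := by
      rw [List.rotate_mod, hn]
    have hlt : n % ((e, true) :: p).length < ((e, true) :: p).length :=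
      Nat.mod_lt _ (by simp)
    generalize n % ((e, true) :: p).length = m at hn' hlt
    have h0 := congrArg List.head? hn'
    rw [List.head?_rotate hlt] at h0
    have h1 : ((e, true) :: p)[m]? = ((e, true) :: p)[0]? := by rw [h0]; rfl
    -- The directed edges of a simple loop are distinct, so only the trivial rotation keeps `(e,
    -- true)` in front.
    have h2 : m = 0 := (List.nodup_iff_getElem?_ne_getElem?.mp hnd |> fun hh => by
      by_contra hm
      exact hh 0 m (Nat.pos_of_ne_zero hm) hlt h1.symm)
    subst h2
    simpa using hn'
  · exfalso
    change ((e, true) :: p).IsRotated (revPath ((e, true) :: q)) at h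
    -- A reversed representative would contain `(e, true)` only if the loop used `e` also backwards.
    have h1 : (e, true) ∈ revPath ((e, true) :: q) := h.mem_iff.mp (by simp)
    simp only [revPath, List.mem_reverse, List.mem_map, List.mem_cons] at h1
    obtain ⟨d, hd | hd, hd'⟩ := h1
    · subst hd; simp [Dart.inv] at hd'
    · have h3 := hq.2.2
      rw [List.map_cons, List.nodup_cons] at h3
      exact h3.1 (List.mem_map.mpr ⟨d, hd, by simpa [Dart.inv] using congrArg Prod.fst hd'⟩)

theorem Loop.edges_nonempty (ℓ : Γ.Loop) : ℓ.edges.Nonempty := by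
  induction ℓ using Quotient.inductionOn with
  | h l =>
    obtain ⟨_ | ⟨a, l⟩, hl⟩ := l
    · exact absurd rfl hl.1
    · exact ⟨a.1, a, by simp, rfl⟩

/-! ### The sum over edge-disjoint loops and its recursion in the edge set. -/

section LoopSum

variable [Fintype E]

open scoped Classical in
/-- The collections of simple loops in `S` no two of which have an edge in common. -/
noncomputable def loopCollections (S : Finset E) : Finset (Finset Γ.Loop) :=
  {L | (L : Set Γ.Loop).PairwiseDisjoint Loop.edges ∧ ∀ ℓ ∈ L, ℓ.edges ⊆ S}

theorem mem_loopCollections {S : Finset E} {L : Finset Γ.Loop} :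
    L ∈ Γ.loopCollections S ↔
      (L : Set Γ.Loop).PairwiseDisjoint Loop.edges ∧ ∀ ℓ ∈ L, ℓ.edges ⊆ S := by
  simp [loopCollections]

/-- The sum of the amplitudes of all collections of edge-disjoint simple loops in `S`. -/
noncomputable def loopSum (T : Param E) (S : Finset E) : ℂ :=
  ∑ L ∈ Γ.loopCollections S, Γ.unionAmp T L

theorem loopSum_empty (T : Param E) : Γ.loopSum T ∅ = 1 := by
  have : Γ.loopCollections ∅ = {∅} := by
    ext L
    rw [mem_loopCollections, Finset.mem_singleton]
    constructor
    · rintro ⟨-, h⟩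
      by_contra hL
      obtain ⟨ℓ, hℓ⟩ := Finset.nonempty_iff_ne_empty.mpr hL
      obtain ⟨e, he⟩ := ℓ.edges_nonempty
      simpa using h ℓ hℓ he
    · rintro rfl; simp
  rw [loopSum, this]; simp [unionAmp]

theorem loopSum_univ (T : Param E) :
    Γ.loopSum T Finset.univ = 1 + ∑ L ∈ Γ.loopUnions, Γ.unionAmp T L := by
  classical
  have : Γ.loopCollections Finset.univ = insert ∅ Γ.loopUnions := by
    ext L
    simp only [mem_loopCollections, loopUnions, Finset.coe_univ, Set.subset_univ, implies_true,
      and_true, Finset.mem_insert, Finset.mem_filter, Finset.mem_univ, true_and]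
    constructor
    · intro h
      rcases L.eq_empty_or_nonempty with hL | hL
      · exact Or.inl hL
      · exact Or.inr ⟨hL, h⟩
    · rintro (rfl | h)
      · simp
      · exact h.2
  rw [loopSum, this, Finset.sum_insert (by simp [loopUnions])]
  simp [unionAmp]

variable [DecidableEq E]

/-- By disjointness at most one loop of a collection contains `e`. Cutting it open at `e` leaves a
path in `S`, and the other loops form a collection on the edges that this path does not use. -/
theorem loopSum_insert (T : Param E) (e : E) (S : Finset E) (he : e ∉ S) :
    Γ.loopSum T (insert e S) = Γ.loopSum T S +
      pathSum (Γ.localMatrix T) (Γ.loopSum T) S (e, false) (e, true) := by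
  classical
  have hsplit : (Γ.loopCollections (insert e S)).filter (fun L => ¬ ∃ ℓ ∈ L, e ∈ ℓ.edges) =
      Γ.loopCollections S := by
    ext L
    simp only [Finset.mem_filter, mem_loopCollections, not_exists, not_and]
    constructor
    · rintro ⟨⟨h1, h2⟩, h3⟩
      refine ⟨h1, fun ℓ hℓ x hx => ?_⟩
      rcases Finset.mem_insert.mp (h2 ℓ hℓ hx) with rfl | h
      · exact absurd hx (h3 ℓ hℓ)
      · exact h
    · rintro ⟨h1, h2⟩
      exact ⟨⟨h1, fun ℓ hℓ x hx => Finset.mem_insert_of_mem (h2 ℓ hℓ hx)⟩,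
        fun ℓ hℓ hx => he (h2 ℓ hℓ hx)⟩
  rw [loopSum, ← Finset.sum_filter_not_add_sum_filter _ (fun L => ∃ ℓ ∈ L, e ∈ ℓ.edges), hsplit]
  congr 1
  rw [pathSum, ← Finset.sum_filter_add_sum_filter_not (paths S)
    (fun p => Γ.IsSimpleLoop ((e, true) :: p))]
  -- Paths that do not close up to a loop have weight zero, since `localMatrix` vanishes between
  -- directed edges with different starting vertices.
  have hz : ∑ p ∈ paths S with ¬ Γ.IsSimpleLoop ((e, true) :: p),
      chain (Γ.localMatrix T) (e, false) p (e, true) *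
        Γ.loopSum T (S \ (p.map Prod.fst).toFinset) = 0 := by
    refine Finset.sum_eq_zero fun p hp => ?_
    obtain ⟨hp, hn⟩ := Finset.mem_filter.mp hp
    obtain ⟨hp1, hp2⟩ := mem_paths.mp hp
    by_contra hne
    exact hn (Γ.isSimpleLoop_cons_of_chain_ne_zero T hp1
      (fun d hd hde => he (hde ▸ hp2 d hd)) (left_ne_zero_of_mul hne))
  rw [hz, add_zero]
  symm
  rw [← Finset.sum_attach]
  simp_rw [loopSum, Finset.mul_sum]
  rw [Finset.sum_sigma']
  let rep : {p // p ∈ (paths S).filter fun p => Γ.IsSimpleLoop ((e, true) :: p)} → Γ.Loop :=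
    fun p => Quotient.mk Γ.loopSetoid ⟨_, (Finset.mem_filter.mp p.2).2⟩
  have hrep : ∀ p, e ∈ (rep p).edges := fun p => ⟨(e, true), by simp, rfl⟩
  have hrepe : ∀ p x, x ∈ (rep p).edges ↔ x = e ∨ x ∈ (p.1.map Prod.fst).toFinset := by
    intro p x
    change (∃ d ∈ (e, true) :: p.1, d.1 = x) ↔ _
    simp [eq_comm]
  have hout : ∀ (S' : Finset E) L, L ∈ Γ.loopCollections (S \ S') → ∀ ℓ ∈ L, e ∉ ℓ.edges := by
    intro S' L hL ℓ hℓ hx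
    exact he (Finset.mem_sdiff.mp ((Γ.mem_loopCollections.mp hL).2 ℓ hℓ hx)).1
  -- A path and a collection on the unused edges are sent to the collection with the closed-up loop
  -- added; the inverse removes the unique loop through `e`.
  refine Finset.sum_bij (fun x _ => insert (rep x.1) x.2) ?_ ?_ ?_ ?_
  · rintro ⟨p, L⟩ hx
    have hL : L ∈ Γ.loopCollections (S \ (p.1.map Prod.fst).toFinset) := (Finset.mem_sigma.mp hx).2
    have hL' := Γ.mem_loopCollections.mp hL
    have hp := mem_paths.mp (Finset.mem_filter.mp p.2).1
    rw [Finset.mem_filter, mem_loopCollections]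
    refine ⟨⟨?_, ?_⟩, rep p, by simp, hrep p⟩
    · rw [Finset.coe_insert]
      refine hL'.1.insert fun ℓ hℓ _ => Set.disjoint_left.mpr fun x hx hx' => ?_
      have h1 := Finset.mem_sdiff.mp (hL'.2 ℓ hℓ hx')
      rcases (hrepe p x).mp hx with rfl | h2
      · exact he h1.1
      · exact h1.2 h2
    · intro ℓ hℓ x hx
      rcases Finset.mem_insert.mp hℓ with rfl | hℓ
      · rcases (hrepe p x).mp hx with rfl | h2
        · simp
        · obtain ⟨d, hd, rfl⟩ := List.mem_map.mp (List.mem_toFinset.mp h2)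
          exact Finset.mem_insert_of_mem (hp.2 d hd)
      · exact Finset.mem_insert_of_mem (Finset.mem_sdiff.mp (hL'.2 ℓ hℓ hx)).1
  · rintro ⟨p, L⟩ hx ⟨q, M⟩ hy hxy
    have hL := hout _ _ (Finset.mem_sigma.mp hx).2
    have hM := hout _ _ (Finset.mem_sigma.mp hy).2
    change insert (rep p) L = insert (rep q) M at hxy
    have h1 : rep p = rep q := by
      have : rep p ∈ insert (rep q) M := hxy ▸ Finset.mem_insert_self _ _
      rcases Finset.mem_insert.mp this with h | h
      · exact h
      · exact absurd (hrep p) (hM _ h)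
    have h2 : p = q := Subtype.ext (Loop.rep_injective Γ _ _ h1)
    subst h2
    have h3 : L = M := by
      have h4 : rep p ∉ L := fun h => hL _ h (hrep p)
      have h5 : rep p ∉ M := fun h => hM _ h (hrep p)
      rw [← Finset.erase_insert h4, hxy, Finset.erase_insert h5]
    rw [h3]
  · intro L hL
    obtain ⟨hL, ℓ, hℓ, heℓ⟩ := Finset.mem_filter.mp hL
    obtain ⟨hL1, hL2⟩ := Γ.mem_loopCollections.mp hL
    obtain ⟨p, hp, rfl⟩ := Loop.exists_rep Γ ℓ heℓ
    have hpe : ∀ d ∈ p, d.1 ∈ S ∧ d.1 ≠ e := by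
      intro d hd
      have h3 := hp.2.2
      rw [List.map_cons, List.nodup_cons] at h3
      have hne : d.1 ≠ e := fun h => h3.1 (List.mem_map.mpr ⟨d, hd, h⟩)
      have := hL2 _ hℓ (show d.1 ∈ _ from ⟨d, by simp [hd], rfl⟩)
      exact ⟨(Finset.mem_insert.mp this).resolve_left hne, hne⟩
    have hpm : p ∈ (paths S).filter fun p => Γ.IsSimpleLoop ((e, true) :: p) := by
      rw [Finset.mem_filter, mem_paths]
      exact ⟨⟨(List.nodup_cons.mp hp.2.2).2, fun d hd => (hpe d hd).1⟩, hp⟩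
    refine ⟨⟨⟨p, hpm⟩, L.erase (rep ⟨p, hpm⟩)⟩, ?_, ?_⟩
    · rw [Finset.mem_sigma]
      refine ⟨Finset.mem_attach _ _, Γ.mem_loopCollections.mpr ⟨?_, ?_⟩⟩
      · exact hL1.subset (by simp)
      · intro ℓ' hℓ' x hx
        obtain ⟨hne, hm⟩ := Finset.mem_erase.mp hℓ'
        have hd := hL1 hm hℓ hne
        have hx' : x ∉ (rep ⟨p, hpm⟩).edges := Set.disjoint_left.mp hd hx
        rw [hrepe] at hx'
        push Not at hx'
        have := hL2 ℓ' hm hx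
        simp only [Finset.coe_sdiff, Set.mem_sdiff]
        exact ⟨(Finset.mem_insert.mp this).resolve_left hx'.1, hx'.2⟩
    · exact Finset.insert_erase hℓ
  · rintro ⟨p, L⟩ hx
    have hL := hout _ _ (Finset.mem_sigma.mp hx).2
    have hnot : rep p ∉ L := fun h => hL _ h (hrep p)
    rw [unionAmp, unionAmp, Finset.prod_insert hnot]
    congr 1
    exact (Γ.pathAmp_cons_eq_chain T (Finset.mem_filter.mp p.2).2).symm

/-- The loop sum is a square root of the determinant, as long as no minor vanishes. -/
theorem loopSum_sq_of_ne_zero (T : Param E)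
    (h : ∀ S : Finset E, (1 - Γ.localMatrix T * edgeForm S).det ≠ 0) :
    Γ.loopSum T Finset.univ ^ 2 = (1 - Γ.localMatrix T * edgeForm Finset.univ).det :=
  (sq_eq_det_of_path_expansion (Γ.localMatrix_transpose T) h (Γ.loopSum T)
    (pathSum (Γ.localMatrix T) (Γ.loopSum T)) (Γ.loopSum_empty T) (Γ.loopSum_insert T)
    (pathSum_eq _ _) Finset.univ).1

end LoopSum

end OGraph

end SpinNetwork

namespace SpinNetwork

/-! ### Rescaling the parameters, and the Pfaffian identity without genericity. -/

theorem det_one_sub_smul {n : Type*} [Fintype n] [DecidableEq n] (s : ℂ) (M : Matrix n n ℂ) :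
    (1 - s • M).det = M.charpolyRev.eval s := by
  rw [Matrix.charpolyRev, ← Polynomial.coe_evalRingHom, RingHom.map_det]
  congr 1
  ext i j
  by_cases h : i = j <;> simp [h, mul_comm s]

namespace OGraph

variable {V E : Type*} (Γ : OGraph V E)

open scoped Classical in
/-- The parameters at every vertex `v`, multiplied by a factor `t v`. -/
noncomputable def rescale (t : V → ℂ) (T : Param E) : Param E where
  τ a b := if Γ.start a = Γ.start b then t (Γ.start a) * T.τ a b else 0
  skew a b := by
    by_cases h : Γ.start a = Γ.start b
    · simp [h, T.skew a b]
    · have h' : ¬ Γ.start b = Γ.start a := fun h' => h h'.symm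
      simp [h, h']

/-- Each directed edge of the loop is the second index of exactly one factor of the amplitude, and
that factor sits at its starting vertex. -/
theorem pathAmp_rescale (t : V → ℂ) (T : Param E) {l : List (Dart E)} (hl : Γ.IsSimpleLoop l) :
    pathAmp (Γ.rescale t T) l = (l.map fun d => t (Γ.start d)).prod * pathAmp T l := by
  have key : ∀ l l' : List (Dart E), l.map Γ.final = l'.map Γ.start →
      (List.zipWith (fun a b => (Γ.rescale t T).τ a.inv b) l l').prod =
        (l'.map fun d => t (Γ.start d)).prod *
          (List.zipWith (fun a b => T.τ a.inv b) l l').prod := by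
    intro l
    induction l with
    | nil => rintro (_ | ⟨b, l'⟩) h <;> simp at h ⊢
    | cons a l ih =>
      rintro (_ | ⟨b, l'⟩) h
      · simp at h
      · simp only [List.map_cons, List.cons.injEq] at h
        have h' : Γ.start a.inv = Γ.start b := by rw [Γ.start_inv, h.1]
        rw [List.zipWith_cons_cons, List.prod_cons, ih l' h.2]
        simp [rescale, h']; ring
  rw [pathAmp, pathAmp, key l (l.rotate 1) (by rw [hl.2.1, List.map_rotate]),
    ((List.rotate_perm l 1).map _).prod_eq]
  ring

theorem Loop.amp_eq (T : Param E) (ℓ : Γ.Loop) : ℓ.amp T = pathAmp T ℓ.out.1 := by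
  conv_lhs => rw [← Quotient.out_eq ℓ]
  rfl

theorem Loop.isCycle_iff (ℓ : Γ.Loop) : ℓ.IsCycle ↔ (ℓ.out.1.map Γ.start).Nodup := by
  conv_lhs => rw [← Quotient.out_eq ℓ]
  rfl

theorem Loop.mem_verts_iff (ℓ : Γ.Loop) (v : V) : v ∈ ℓ.verts ↔ v ∈ ℓ.out.1.map Γ.start := by
  conv_lhs => rw [← Quotient.out_eq ℓ]
  rw [List.mem_map]
  rfl

theorem unionAmp_rescale (t : V → ℂ) (T : Param E) (L : Finset Γ.Loop) :
    Γ.unionAmp (Γ.rescale t T) L =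
      (∏ ℓ ∈ L, (ℓ.out.1.map fun d => t (Γ.start d)).prod) * Γ.unionAmp T L := by
  rw [unionAmp, unionAmp, ← Finset.prod_mul_distrib]
  refine Finset.prod_congr rfl fun ℓ _ => ?_
  rw [Loop.amp_eq, Loop.amp_eq, Γ.pathAmp_rescale t T ℓ.out.2]

theorem localMatrix_rescale_const (s : ℂ) (T : Param E) :
    Γ.localMatrix (Γ.rescale (fun _ => s) T) = s • Γ.localMatrix T := by
  ext a b
  by_cases h : Γ.start a = Γ.start b <;> simp [localMatrix, rescale, h]

variable [Fintype E] [DecidableEq E]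

/-- The sum over the collections of edge-disjoint simple loops is a Pfaffian. -/
theorem loopSum_sq (T : Param E) :
    Γ.loopSum T Finset.univ ^ 2 = (1 - Γ.localMatrix T * edgeForm Finset.univ).det := by
  classical
  -- After scaling all parameters by `s`, the determinants for all `S` are polynomials in `s` with
  -- value `1` at `s = 0`. So they are all nonzero off a finite set of `s`, and continuity carries
  -- the identity to `s = 1`.
  let q : Polynomial ℂ := ∏ S : Finset E, (Γ.localMatrix T * edgeForm S).charpolyRev
  have hq : q ≠ 0 := by
    refine Finset.prod_ne_zero_iff.mpr fun S _ h => ?_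
    have := Matrix.eval_charpolyRev (M := Γ.localMatrix T * edgeForm S)
    rw [h] at this; simp at this
  let f : ℂ → ℂ := fun s => Γ.loopSum (Γ.rescale (fun _ => s) T) Finset.univ ^ 2
  let g : ℂ → ℂ := fun s => (Γ.localMatrix T * edgeForm Finset.univ).charpolyRev.eval s
  have hf : Continuous f := by
    simp only [f, loopSum, unionAmp_rescale, List.map_const', List.prod_replicate]
    fun_prop
  have hg : Continuous g := Polynomial.continuous _
  have hfg : f = g := by
    have hd : Dense {s : ℂ | q.IsRoot s}ᶜ := (Polynomial.finite_setOfPred_isRoot hq).countable.dense_compl ℂ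
    refine hf.ext_on hd hg fun s hs => ?_
    have hs' : ∀ S : Finset E,
        (1 - Γ.localMatrix (Γ.rescale (fun _ => s) T) * edgeForm S).det ≠ 0 := by
      intro S
      rw [localMatrix_rescale_const, Matrix.smul_mul, det_one_sub_smul]
      intro h
      refine hs ?_
      rw [Set.mem_ofPred_eq, Polynomial.IsRoot.def, Polynomial.eval_prod]
      exact Finset.prod_eq_zero (Finset.mem_univ S) h
    simp only [f, g]
    rw [Γ.loopSum_sq_of_ne_zero _ hs', localMatrix_rescale_const, Matrix.smul_mul, det_one_sub_smul]
  have h1 := congrFun hfg 1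
  simp only [f, g, ← det_one_sub_smul, one_smul, loopSum, unionAmp_rescale] at h1
  simpa [loopSum] using h1

end OGraph

/-! ### Duality between directed edges and the two components at each vertex. -/

section Duality

variable {V E : Type*} (Γ : OGraph V E)

/-- The components of the spinor of a directed edge, placed at its starting vertex. -/
noncomputable def incidence [DecidableEq V] (z : Dart E → Spinor) :
    Matrix (Dart V) (Dart E) ℂ :=
  Matrix.of fun b d => if b.1 = Γ.start d then (if b.2 then -z d 1 else z d 0) else 0

variable [DecidableEq V]

/-- The bracket is a symplectic form on `ℂ²`. So the parameters are pulled back from the form that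
pairs the two components at each vertex; here vertices take the place of edges in `edgeForm`. -/
theorem localMatrix_rescale_spinorParam [Fintype V] (z : Dart E → Spinor) (t : V → ℂ) :
    Γ.localMatrix (Γ.rescale t (spinorParam z)) =
      -((incidence Γ z).transpose * edgeForm (Finset.univ : Finset V) *
        (Matrix.diagonal (fun b : Dart V => t b.1) * incidence Γ z)) := by
  ext a b
  rw [Matrix.neg_apply, Matrix.mul_assoc, Matrix.mul_apply, Fintype.sum_prod_type,
    Finset.sum_eq_single (Γ.start a) (fun v _ hv => by simp [incidence, hv]) (by simp)]
  by_cases h : Γ.start a = Γ.start b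
  · simp [incidence, edgeForm_mul_apply, dartSign, Dart.inv, h, OGraph.localMatrix,
      OGraph.rescale, spinorParam, bracket, Matrix.diagonal_mul]
    ring
  · simp [incidence, edgeForm_mul_apply, dartSign, Dart.inv, h, OGraph.localMatrix,
      OGraph.rescale, Matrix.diagonal_mul]

variable [Fintype E] [DecidableEq E]

/-- The form on the directions at the vertices that is dual to the one on the directed edges. -/
noncomputable def vertexMatrix (z : Dart E → Spinor) : Matrix (Dart V) (Dart V) ℂ :=
  -(incidence Γ z * edgeForm (Finset.univ : Finset E) * (incidence Γ z).transpose)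

theorem vertexMatrix_transpose (z : Dart E → Spinor) :
    (vertexMatrix Γ z).transpose = -vertexMatrix Γ z := by
  rw [vertexMatrix, Matrix.transpose_neg, Matrix.transpose_mul, Matrix.transpose_mul,
    Matrix.transpose_transpose, edgeForm_transpose]
  simp [Matrix.mul_assoc]

variable [Fintype V]

/-- Sylvester's identity moves the determinant from directed edges to vertex components, where each
variable `t v` occupies only two rows. -/
theorem det_localMatrix_rescale (z : Dart E → Spinor) (t : V → ℂ) :
    (1 - Γ.localMatrix (Γ.rescale t (spinorParam z)) * edgeForm Finset.univ).det =
      (1 - Matrix.diagonal (fun b : Dart V => t b.1) *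
        (vertexMatrix Γ z * edgeForm Finset.univ)).det := by
  rw [localMatrix_rescale_spinorParam, Matrix.neg_mul, sub_neg_eq_add, Matrix.mul_assoc,
    Matrix.det_one_add_mul_comm, vertexMatrix, Matrix.neg_mul, Matrix.mul_neg, sub_neg_eq_add]
  simp only [Matrix.mul_assoc]

theorem det_localMatrix_eq_vertexMatrix (z : Dart E → Spinor) :
    (1 - Γ.localMatrix (spinorParam z) * edgeForm Finset.univ).det =
      (1 - vertexMatrix Γ z * edgeForm Finset.univ).det := by
  have h := det_localMatrix_rescale Γ z (fun _ => 1)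
  rw [Γ.localMatrix_rescale_const] at h
  simpa using h

end Duality

end SpinNetwork

namespace SpinNetwork

/-! ### Counting visits by degree: only disjoint cycle unions survive. -/

section Degree

open MvPolynomial

/-- The determinant of a matrix of polynomials, `m` of whose rows are linear in the variable `v`
and the others free of it, has degree at most `m` in `v`. -/
theorem degreeOf_det_le {n σ : Type*} [Fintype n] [DecidableEq n] (M : Matrix n n (MvPolynomial σ ℂ))
    (v : σ) (d : n → ℕ) (h : ∀ i j, degreeOf v (M i j) ≤ d i) :
    degreeOf v M.det ≤ ∑ i, d i := by
  rw [Matrix.det_apply']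
  refine (degreeOf_sum_le _ _ _).trans (Finset.sup_le fun π _ => ?_)
  have hc : ((Equiv.Perm.sign π : ℤ) : MvPolynomial σ ℂ) = C ((Equiv.Perm.sign π : ℤ) : ℂ) := by
    simp
  rw [hc]
  refine (degreeOf_C_mul_le _ _ _).trans ((degreeOf_prod_le _ _ _).trans ?_)
  rw [← Equiv.sum_comp π d]
  exact Finset.sum_le_sum fun i _ => h _ _

end Degree

namespace OGraph

variable {V E : Type*} (Γ : OGraph V E)

/-- The number of visits that the loops of a collection pay to every vertex. -/
noncomputable def visits (L : Finset Γ.Loop) : V →₀ ℕ :=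
  ∑ ℓ ∈ L, (ℓ.out.1.map fun d => Finsupp.single (Γ.start d) 1).sum

theorem prod_visits (t : V → ℂ) (L : Finset Γ.Loop) :
    (Γ.visits L).prod (fun v n => t v ^ n) =
      ∏ ℓ ∈ L, (ℓ.out.1.map fun d => t (Γ.start d)).prod := by
  classical
  rw [visits, ← Finsupp.prod_finsetSum_index (by simp) (by intros; rw [pow_add])]
  refine Finset.prod_congr rfl fun ℓ _ => ?_
  generalize ℓ.out.1 = l
  induction l with
  | nil => simp
  | cons a l ih =>
    rw [List.map_cons, List.sum_cons, Finsupp.prod_add_index' (by simp) (by intros; rw [pow_add]),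
      ih]
    simp

theorem visits_apply [DecidableEq V] (L : Finset Γ.Loop) (v : V) :
    Γ.visits L v = ∑ ℓ ∈ L, (ℓ.out.1.map Γ.start).count v := by
  rw [visits, Finsupp.finsetSum_apply]
  refine Finset.sum_congr rfl fun ℓ _ => ?_
  generalize ℓ.out.1 = l
  induction l with
  | nil => simp
  | cons a l ih =>
    rw [List.map_cons, List.sum_cons, Finsupp.add_apply, ih, List.map_cons, List.count_cons]
    simp [Finsupp.single_apply, add_comm]

/-- For an edge-disjoint collection, being a disjoint cycle union is thus a condition on the
multidegree alone. -/
theorem visits_le_one_iff (L : Finset Γ.Loop) :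
    (∀ v, Γ.visits L v ≤ 1) ↔
      (∀ c ∈ L, c.IsCycle) ∧ (L : Set Γ.Loop).PairwiseDisjoint Loop.verts := by
  classical
  simp only [visits_apply]
  constructor
  · intro h
    refine ⟨fun c hc => ?_, fun c hc d hd hcd => ?_⟩
    · rw [Loop.isCycle_iff, List.nodup_iff_count_le_one]
      exact fun v => (Finset.single_le_sum (f := fun ℓ : Γ.Loop => (ℓ.out.1.map Γ.start).count v)
        (fun _ _ => Nat.zero_le _) hc).trans (h v)
    · refine Set.disjoint_left.mpr fun v hv hv' => ?_
      rw [Loop.mem_verts_iff, ← List.one_le_count_iff] at hv hv'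
      have h1 := Finset.sum_le_sum_of_subset (f := fun ℓ : Γ.Loop => (ℓ.out.1.map Γ.start).count v)
        (show {c, d} ⊆ L from by
          intro x hx
          rcases Finset.mem_insert.mp hx with rfl | hx
          · exact hc
          · exact Finset.mem_singleton.mp hx ▸ hd)
      rw [Finset.sum_pair hcd] at h1
      have := h v
      omega
  · rintro ⟨h1, h2⟩ v
    by_cases hv : ∃ c ∈ L, v ∈ c.verts
    · obtain ⟨c, hc, hv⟩ := hv
      rw [Finset.sum_eq_single_of_mem c hc]
      · exact List.nodup_iff_count_le_one.mp ((Loop.isCycle_iff Γ c).mp (h1 c hc)) v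
      · intro d hd hdc
        rw [List.count_eq_zero, ← Loop.mem_verts_iff]
        exact Set.disjoint_left.mp (h2 hc hd hdc.symm) hv
    · rw [Finset.sum_eq_zero]
      · simp
      · intro d hd
        rw [List.count_eq_zero, ← Loop.mem_verts_iff]
        exact fun h => hv ⟨d, hd, h⟩

section CycleSum

variable [Fintype E]

open MvPolynomial

/-- The generating polynomial of the collections of loops by the numbers of visits. -/
noncomputable def loopPoly (T : Param E) : MvPolynomial V ℂ :=
  ∑ L ∈ Γ.loopCollections Finset.univ, monomial (Γ.visits L) (Γ.unionAmp T L)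

theorem eval_loopPoly (T : Param E) (t : V → ℂ) :
    eval t (Γ.loopPoly T) = Γ.loopSum (Γ.rescale t T) Finset.univ := by
  rw [loopPoly, map_sum, loopSum]
  refine Finset.sum_congr rfl fun L _ => ?_
  rw [eval_monomial, unionAmp_rescale, ← prod_visits, mul_comm]

/-- The square of the polynomial is a determinant in which only the two rows at `v` contain the
variable of `v`. Its degree there is at most two, and taking the square root halves it. -/
theorem degreeOf_loopPoly_le [Fintype V] (z : Dart E → Spinor) (v : V) :
    degreeOf v (Γ.loopPoly (spinorParam z)) ≤ 1 := by
  classical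
  let W := vertexMatrix Γ z * edgeForm (Finset.univ : Finset V)
  let M : Matrix (Dart V) (Dart V) (MvPolynomial V ℂ) := Matrix.of fun b c =>
    C ((1 : Matrix (Dart V) (Dart V) ℂ) b c) - C (W b c) * X b.1
  have hM : Γ.loopPoly (spinorParam z) ^ 2 = M.det := by
    refine MvPolynomial.funext fun t => ?_
    rw [map_pow, eval_loopPoly, loopSum_sq, det_localMatrix_rescale, RingHom.map_det]
    congr 1
    ext b c
    simp [M, Matrix.diagonal_mul, W, mul_comm]
  have hdeg : degreeOf v M.det ≤ 2 := by
    refine (degreeOf_det_le M v (fun b => if b.1 = v then 1 else 0) fun b c => ?_).trans ?_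
    · have h0 : degreeOf v (C (W b c) * X b.1 : MvPolynomial V ℂ) ≤ if b.1 = v then 1 else 0 := by
        refine (degreeOf_C_mul_le _ _ _).trans ?_
        rw [degreeOf_X]
        simp [eq_comm]
      change degreeOf v (C _ - C (W b c) * X b.1) ≤ _
      rw [sub_eq_add_neg, ← neg_mul, ← C_neg]
      refine (degreeOf_add_le _ _ _).trans (max_le ?_ ?_)
      · rw [degreeOf_C]; exact Nat.zero_le _
      · refine (degreeOf_C_mul_le _ _ _).trans ?_
        rw [degreeOf_X]
        simp [eq_comm]
    · rw [Fintype.sum_prod_type, Finset.sum_eq_single v (fun w _ hw => by simp [hw]) (by simp)]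
      simp
  by_cases h : Γ.loopPoly (spinorParam z) = 0
  · rw [h]; simp
  · rw [← hM, degreeOf_pow_eq _ _ _ h] at hdeg
    omega

/-- Only the disjoint cycle unions survive in the sum over collections of edge-disjoint loops. -/
theorem loopSum_spinorParam [Fintype V] (z : Dart E → Spinor) :
    Γ.loopSum (spinorParam z) Finset.univ = Γ.cycleSum z := by
  classical
  have hset : (Γ.loopCollections Finset.univ).filter (fun L => ∀ v, Γ.visits L v ≤ 1) =
      insert ∅ Γ.cycleUnions := by
    ext L
    simp only [Finset.mem_filter, mem_loopCollections, visits_le_one_iff, cycleUnions,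
      Finset.mem_insert, Finset.mem_univ, true_and, Finset.coe_univ, Set.subset_univ, implies_true,
      and_true]
    constructor
    · rintro ⟨h1, h2, h3⟩
      rcases L.eq_empty_or_nonempty with hL | hL
      · exact Or.inl hL
      · exact Or.inr ⟨hL, h2, h1, h3⟩
    · rintro (rfl | ⟨-, h2, h1, h3⟩)
      · simp
      · exact ⟨h1, h2, h3⟩
  rw [loopSum, ← Finset.sum_filter_add_sum_filter_not _ (fun L => ∀ v, Γ.visits L v ≤ 1), hset,
    Finset.sum_insert (by simp [cycleUnions]), cycleSum]
  have h0 : ∑ L ∈ Γ.loopCollections Finset.univ with ¬ ∀ v, Γ.visits L v ≤ 1,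
      Γ.unionAmp (spinorParam z) L = 0 := by
    -- The remaining collections are grouped by their visits. Each group sums to one coefficient of
    -- `loopPoly`, which vanishes because some exponent exceeds one.
    rw [← Finset.sum_fiberwise_of_maps_to (g := Γ.visits) (t := Finset.image Γ.visits
      ((Γ.loopCollections Finset.univ).filter fun L => ¬ ∀ v, Γ.visits L v ≤ 1))
      fun L hL => Finset.mem_image_of_mem _ hL]
    refine Finset.sum_eq_zero fun m hm => ?_
    obtain ⟨L₀, hL₀, rfl⟩ := Finset.mem_image.mp hm
    obtain ⟨v, hv⟩ := not_forall.mp (Finset.mem_filter.mp hL₀).2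
    have h1 : coeff (Γ.visits L₀) (Γ.loopPoly (spinorParam z)) = 0 := by
      by_contra hne
      have := degreeOf_le_iff.mp (Γ.degreeOf_loopPoly_le z v) _ (mem_support_iff.mpr hne)
      omega
    rw [loopPoly, coeff_sum] at h1
    simp only [coeff_monomial] at h1
    rw [← h1, Finset.filter_filter, Finset.sum_filter]
    refine Finset.sum_congr rfl fun L _ => ?_
    by_cases h : Γ.visits L = Γ.visits L₀
    · have h2 : ¬ ∀ w, Γ.visits L₀ w ≤ 1 := fun hw => hv (hw v)
      simp only [h, and_true]
      rw [if_pos h2, if_pos trivial]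
    · simp [h]
  rw [h0]
  simp [unionAmp]

theorem cycleSum_sq [Fintype V] [DecidableEq E] (z : Dart E → Spinor) :
    Γ.cycleSum z ^ 2 = (1 - Γ.localMatrix (spinorParam z) * edgeForm Finset.univ).det := by
  rw [← loopSum_spinorParam, loopSum_sq]

end CycleSum

/-! ### The cancellation at a vertex -/

theorem isPlucker_spinorParam (z : Dart E → Spinor) : Γ.IsPlucker (spinorParam z) := by
  intro a b c d _ _ _
  simp only [spinorParam, bracket]
  ring

theorem prod_zipWith_join (f : Dart E → Dart E → ℂ) (a : Dart E) (p : List (Dart E))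
    (b : Dart E) (q r : List (Dart E)) :
    (List.zipWith f (a :: p ++ b :: q) (p ++ b :: r)).prod =
      (List.zipWith f (a :: p) p).prod * f ((a :: p).getLast (by simp)) b *
        (List.zipWith f (b :: q) r).prod := by
  induction p generalizing a with
  | nil => simp
  | cons c p ih =>
    have := ih c
    simp only [List.cons_append, List.zipWith_cons_cons, List.prod_cons] at this ⊢
    rw [this]
    simp [mul_assoc]

theorem prod_zipWith_concat (f : Dart E → Dart E → ℂ) (a : Dart E) (p : List (Dart E))
    (b : Dart E) :
    (List.zipWith f (a :: p) (p ++ [b])).prod =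
      (List.zipWith f (a :: p) p).prod * f ((a :: p).getLast (by simp)) b := by
  induction p generalizing a with
  | nil => simp
  | cons c p ih =>
    have := ih c
    simp only [List.cons_append, List.zipWith_cons_cons, List.prod_cons] at this ⊢
    rw [this]
    simp [mul_assoc]

theorem revPath_cons (b : Dart E) (q : List (Dart E)) :
    revPath (b :: q) = revPath q ++ [b.inv] := by
  simp [revPath]

/-- Reversal swaps the arguments of each inner factor, and there are `q.length` of them. -/
theorem prod_zipWith_revPath (T : Param E) (b : Dart E) (q : List (Dart E)) {b' : Dart E}
    {q' : List (Dart E)} (h : revPath (b :: q) = b' :: q') :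
    (List.zipWith (fun a b => T.τ a.inv b) (b' :: q') q').prod =
      (-1) ^ q.length * (List.zipWith (fun a b => T.τ a.inv b) (b :: q) q).prod := by
  induction q generalizing b q' with
  | nil =>
    have : q' = [] := by
      have := congrArg List.length h
      simpa [revPath, eq_comm] using this
    subst this; simp
  | cons c q ih =>
    obtain ⟨x, r, hr⟩ := List.exists_cons_of_ne_nil
      (show revPath (c :: q) ≠ [] by simp [revPath])
    rw [revPath_cons, hr, List.cons_append, List.cons.injEq] at h
    obtain ⟨rfl, rfl⟩ := h
    have hlast : (x :: r).getLast (by simp) = c.inv := by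
      have h1 : (x :: r).getLast? = (revPath q ++ [c.inv]).getLast? := by
        rw [← hr, revPath_cons]
      rw [List.getLast?_eq_some_getLast (by simp), List.getLast?_concat] at h1
      exact Option.some.inj h1
    have h2 := prod_zipWith_join (fun a b => T.τ a.inv b) x r b.inv [] []
    rw [← List.cons_append, h2, hlast, ih c hr, List.zipWith_cons_cons, List.prod_cons,
      List.length_cons, Dart.inv_inv, T.skew b.inv c, pow_succ]
    simp; ring

theorem pathAmp_cons (T : Param E) (a : Dart E) (p : List (Dart E)) :
    pathAmp T (a :: p) = -(-1) ^ ((a :: p).countP fun d => d.2) *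
      ((List.zipWith (fun a b => T.τ a.inv b) (a :: p) p).prod *
        T.τ ((a :: p).getLast (by simp)).inv a) := by
  have h : (a :: p).rotate 1 = p ++ [a] := by simp
  rw [pathAmp, h, prod_zipWith_concat]

theorem pathAmp_append (T : Param E) (a : Dart E) (p : List (Dart E)) (b : Dart E)
    (q : List (Dart E)) :
    pathAmp T (a :: p ++ b :: q) = -((-1) ^ ((a :: p).countP fun d => d.2) *
      (-1) ^ ((b :: q).countP fun d => d.2)) *
      ((List.zipWith (fun a b => T.τ a.inv b) (a :: p) p).prod *
        T.τ ((a :: p).getLast (by simp)).inv b *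
        ((List.zipWith (fun a b => T.τ a.inv b) (b :: q) q).prod *
        T.τ ((b :: q).getLast (by simp)).inv a)) := by
  have h : (a :: p ++ b :: q).rotate 1 = p ++ b :: (q ++ [a]) := by simp
  rw [pathAmp, h, prod_zipWith_join, prod_zipWith_concat, List.countP_append, pow_add]

/-- Both pieces start and end at the common vertex, so either can be closed up on its own, or the
second can be reversed in place. -/
theorem isSimpleLoop_split {a b : Dart E} {p q : List (Dart E)}
    (h : Γ.IsSimpleLoop ((a :: p) ++ (b :: q))) (hab : Γ.start a = Γ.start b) :
    Γ.IsSimpleLoop (a :: p) ∧ Γ.IsSimpleLoop (b :: q) ∧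
      Γ.IsSimpleLoop ((a :: p) ++ revPath (b :: q)) := by
  obtain ⟨-, h1, h2⟩ := h
  have h3 : (a :: p).map Γ.final ++ (b :: q).map Γ.final =
      (p.map Γ.start ++ [Γ.start b]) ++ (q.map Γ.start ++ [Γ.start a]) := by
    rw [← List.map_append, h1]; simp
  obtain ⟨h4, h5⟩ := List.append_inj h3 (by simp)
  rw [List.map_append, List.nodup_append] at h2
  refine ⟨⟨by simp, ?_, h2.1⟩, ⟨by simp, ?_, h2.2.1⟩, by simp, ?_, ?_⟩
  · rw [h4]; simp [hab]
  · rw [h5]; simp [hab]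
  · have hs : (revPath (b :: q)).map Γ.start = ((b :: q).map Γ.final).reverse := by
      rw [revPath, List.map_reverse, List.map_map]
      congr 2
      exact funext Γ.start_inv
    have hf : (revPath (b :: q)).map Γ.final = ((b :: q).map Γ.start).reverse := by
      rw [revPath, List.map_reverse, List.map_map]
      congr 2
      exact funext Γ.final_inv
    rw [List.map_append, List.map_append, hs, hf, h4, h5]
    simp [hab]
  · have hfst : (revPath (b :: q)).map Prod.fst = ((b :: q).map Prod.fst).reverse := by
      rw [revPath, List.map_reverse, List.map_map]
      rfl
    rw [List.map_append, hfst, List.nodup_append]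
    refine ⟨h2.1, List.nodup_reverse.mpr h2.2.1, fun x hx y hy => ?_⟩
    exact h2.2.2 x hx y (List.mem_reverse.mp hy)

theorem start_inv_getLast {a : Dart E} {p : List (Dart E)} (h : Γ.IsSimpleLoop (a :: p)) :
    Γ.start ((a :: p).getLast (by simp)).inv = Γ.start a := by
  have h1 := congrArg List.getLast? h.2.1
  rw [Γ.start_inv]
  simpa [List.getLast?_cons, List.getLast_eq_getLastD] using h1

/-- The three ways to resolve a crossing of loops cancel. -/
theorem resolutions_cancel {T : Param E} (hT : Γ.IsPlucker T) {a b : Dart E}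
    {p q : List (Dart E)} (h : Γ.IsSimpleLoop ((a :: p) ++ (b :: q)))
    (hab : Γ.start a = Γ.start b) :
    pathAmp T (a :: p) * pathAmp T (b :: q) + pathAmp T ((a :: p) ++ revPath (b :: q))
      + pathAmp T ((a :: p) ++ (b :: q)) = 0 := by
  obtain ⟨hp, hq, -⟩ := Γ.isSimpleLoop_split h hab
  obtain ⟨b', q', hr⟩ := List.exists_cons_of_ne_nil
    (show revPath (b :: q) ≠ [] by simp [revPath])
  have hb' : b' = ((b :: q).getLast (by simp)).inv := by
    have h1 : (b' :: q').head? = (revPath (b :: q)).head? := by rw [hr]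
    rw [revPath, List.head?_reverse, List.getLast?_map,
      List.getLast?_eq_some_getLast (by simp)] at h1
    exact Option.some.inj h1
  have hlast : ((b' :: q').getLast (by simp)) = b.inv := by
    have h1 : (b' :: q').getLast? = (revPath q ++ [b.inv]).getLast? := by
      rw [← hr, revPath_cons]
    rw [List.getLast?_eq_some_getLast (by simp), List.getLast?_concat] at h1
    exact Option.some.inj h1
  -- Every edge of the second piece is along the orientation in exactly one of the two directions of
  -- traversal. As the piece has `q.length + 1` edges, an extra minus sign remains after the signs
  -- of the inner factors cancel.
  have hcount : (-1 : ℂ) ^ ((b' :: q').countP fun d => d.2) =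
      -((-1) ^ q.length * (-1) ^ ((b :: q).countP fun d => d.2)) := by
    have h1 := countP_inv (b :: q)
    rw [← (List.reverse_perm ((b :: q).map Dart.inv)).countP_eq] at h1
    change (revPath (b :: q)).countP (fun d => d.2) + _ = _ at h1
    rw [hr, List.length_cons] at h1
    have h2 : (-1 : ℂ) ^ ((b :: q).countP fun d => d.2) *
        (-1) ^ ((b :: q).countP fun d => d.2) = 1 := by
      rw [← mul_pow]; simp
    have h3 := congrArg (fun n => (-1 : ℂ) ^ n) h1
    simp only [pow_add, pow_one] at h3
    linear_combination (-1 : ℂ) ^ ((b :: q).countP fun d => d.2) * h3 -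
      (-1 : ℂ) ^ ((b' :: q').countP fun d => d.2) * h2
  have hsq : (-1 : ℂ) ^ q.length * (-1) ^ q.length = 1 := by
    rw [← mul_pow]; simp
  -- The Plücker relation is applied to the four ends at the crossing: the inverse of the last edge
  -- and the first edge of each piece. Its three terms are the three ways to join them in pairs.
  have hpl := hT ((a :: p).getLast (by simp)).inv a b' b (Γ.start_inv_getLast hp)
    (by rw [Γ.start_inv_getLast hp, hb', Γ.start_inv_getLast hq, hab])
    ((Γ.start_inv_getLast hp).trans hab)
  rw [hr, pathAmp_append, pathAmp_append, pathAmp_cons, pathAmp_cons, hcount,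
    prod_zipWith_revPath T b q hr, hlast, Dart.inv_inv, ← hb']
  have hs := T.skew a b
  have hs' := T.skew a b'
  rw [hs, hs']
  rw [hs] at hpl
  generalize (List.zipWith (fun a b => T.τ a.inv b) (a :: p) p).prod = P
  generalize (List.zipWith (fun a b => T.τ a.inv b) (b :: q) q).prod = Q
  linear_combination ((-1) ^ ((a :: p).countP fun d => d.2) *
    (-1) ^ ((b :: q).countP fun d => d.2) * P * Q) * hpl -
    ((-1) ^ ((a :: p).countP fun d => d.2) *
    (-1) ^ ((b :: q).countP fun d => d.2) * P * Q) *
    T.τ ((a :: p).getLast (by simp)).inv b' * T.τ a b * hsq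

end OGraph

end SpinNetwork

namespace SpinNetwork

/-! ### Gaussian integrals over `ℂ`. -/

section ComplexGaussian

open Complex

theorem gaussian_split (κ p q : ℂ) (x y : ℝ) :
    cexp (-κ * (‖(⟨x, y⟩ : ℂ)‖ : ℂ) ^ 2 + p * ⟨x, y⟩ + q * (starRingEnd ℂ) ⟨x, y⟩) =
      cexp (-κ * (x : ℂ) ^ 2 + (p + q) * x + 0) * cexp (-κ * (y : ℂ) ^ 2 + I * (p - q) * y + 0) := by
  rw [← Complex.exp_add]
  congr 1
  have h1 : (‖(⟨x, y⟩ : ℂ)‖ : ℂ) ^ 2 = (x : ℂ) ^ 2 + (y : ℂ) ^ 2 := by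
    rw [← Complex.ofReal_pow, Complex.sq_norm, Complex.normSq_mk]
    push_cast; ring
  have h2 : (⟨x, y⟩ : ℂ) = x + y * I := Complex.mk_eq_add_mul_I x y
  have h3 : (starRingEnd ℂ) (⟨x, y⟩ : ℂ) = x - y * I := by
    rw [h2]; simp [sub_eq_add_neg]
  rw [h1, h3, h2]
  ring

theorem integrable_complex_gaussian {κ : ℂ} (hκ : 0 < κ.re) (p q : ℂ) :
    Integrable fun w : ℂ => cexp (-κ * (‖w‖ : ℂ) ^ 2 + p * w + q * (starRingEnd ℂ) w) := by
  rw [← (Complex.volume_preserving_equiv_real_prod.symm).integrable_comp_emb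
    (MeasurableEquiv.measurableEmbedding _)]
  refine ((integrable_cexp_quadratic hκ (p + q) 0).mul_prod
    (integrable_cexp_quadratic hκ (I * (p - q)) 0)).congr (ae_of_all _ fun z => ?_)
  exact (gaussian_split κ p q z.1 z.2).symm

/-- The integral factors into two real Gaussians, whose square roots multiply to `π / κ`. The linear
terms `p + q` and `I (p - q)` combine through `(p + q)² - (p - q)² = 4pq`. -/
theorem integral_complex_gaussian {κ : ℂ} (hκ : 0 < κ.re) (p q : ℂ) :
    ∫ w : ℂ, cexp (-κ * (‖w‖ : ℂ) ^ 2 + p * w + q * (starRingEnd ℂ) w) =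
      Real.pi / κ * cexp (p * q / κ) := by
  have hκ0 : κ ≠ 0 := by rintro rfl; simp at hκ
  rw [← (Complex.volume_preserving_equiv_real_prod.symm).integral_comp'
    (f := Complex.measurableEquivRealProd.symm)]
  have h1 : ∀ z : ℝ × ℝ, cexp (-κ * (‖Complex.measurableEquivRealProd.symm z‖ : ℂ) ^ 2 +
      p * Complex.measurableEquivRealProd.symm z +
      q * (starRingEnd ℂ) (Complex.measurableEquivRealProd.symm z)) =
      cexp (-κ * (z.1 : ℂ) ^ 2 + (p + q) * z.1 + 0) *
        cexp (-κ * (z.2 : ℂ) ^ 2 + I * (p - q) * z.2 + 0) :=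
    fun z => gaussian_split κ p q z.1 z.2
  simp_rw [h1]
  rw [Measure.volume_eq_prod, integral_prod_mul (f := fun x : ℝ =>
    cexp (-κ * (x : ℂ) ^ 2 + (p + q) * x + 0)) (g := fun y : ℝ =>
    cexp (-κ * (y : ℂ) ^ 2 + I * (p - q) * y + 0)),
    integral_cexp_quadratic (by simpa using hκ), integral_cexp_quadratic (by simpa using hκ)]
  have hpk : (Real.pi / - -κ : ℂ) ≠ 0 := by
    simp [hκ0, Real.pi_ne_zero]
  have h2 : (Real.pi / - -κ : ℂ) ^ (1 / 2 : ℂ) * (Real.pi / - -κ : ℂ) ^ (1 / 2 : ℂ) =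
      Real.pi / κ := by
    rw [← Complex.cpow_add _ _ hpk]
    norm_num
  rw [mul_mul_mul_comm, h2, ← Complex.exp_add]
  congr 2
  have hI := Complex.I_sq
  field_simp
  rw [hI]
  ring

end ComplexGaussian

/-! ### Gaussians of one spinor under the Bargmann measure. -/

section Bargmann

open Complex

/-- The density of the Bargmann measure. -/
noncomputable def bargmannDensity (w : Spinor) : ℝ :=
  (Real.pi ^ 2)⁻¹ * Real.exp (-(‖w 0‖ ^ 2 + ‖w 1‖ ^ 2))

theorem continuous_bargmannDensity : Continuous bargmannDensity := by
  unfold bargmannDensity; fun_prop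

theorem bargmannDensity_nonneg (w : Spinor) : 0 ≤ bargmannDensity w := by
  unfold bargmannDensity; positivity

theorem bargmann_eq :
    bargmann = volume.withDensity fun w => ENNReal.ofReal (bargmannDensity w) := rfl

theorem integrable_bargmann_iff {F : Type*} [NormedAddCommGroup F] [NormedSpace ℝ F]
    {g : Spinor → F} :
    Integrable g bargmann ↔ Integrable fun w => bargmannDensity w • g w := by
  rw [bargmann_eq, integrable_withDensity_iff_integrable_smul'
    (continuous_bargmannDensity.measurable.ennreal_ofReal) (by simp)]
  refine integrable_congr (ae_of_all _ fun w => ?_)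
  simp only [ENNReal.toReal_ofReal (bargmannDensity_nonneg w)]

theorem integral_bargmann {F : Type*} [NormedAddCommGroup F] [NormedSpace ℝ F] (g : Spinor → F) :
    ∫ w, g w ∂bargmann = ∫ w, bargmannDensity w • g w := by
  rw [bargmann_eq, integral_withDensity_eq_integral_toReal_smul
    (continuous_bargmannDensity.measurable.ennreal_ofReal) (by simp)]
  refine integral_congr_ae (ae_of_all _ fun w => ?_)
  simp only [ENNReal.toReal_ofReal (bargmannDensity_nonneg w)]

instance : SigmaFinite bargmann := by
  unfold bargmann; infer_instance

/-- The exponent of a Gaussian in one spinor. -/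
noncomputable def spinorExponent (α : ℂ) (p q : Spinor) (w : Spinor) : ℂ :=
  α * ((‖w 0‖ : ℂ) ^ 2 + (‖w 1‖ : ℂ) ^ 2) + (p 0 * w 0 + p 1 * w 1) +
    (q 0 * (starRingEnd ℂ) (w 0) + q 1 * (starRingEnd ℂ) (w 1))

theorem density_smul_exp (α : ℂ) (p q w : Spinor) :
    bargmannDensity w • cexp (spinorExponent α p q w) = ∏ i : Fin 2,
      ((Real.pi : ℂ)⁻¹ * cexp (-(1 - α) * (‖w i‖ : ℂ) ^ 2 + p i * w i +
        q i * (starRingEnd ℂ) (w i))) := by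
  rw [Fin.prod_univ_two, mul_mul_mul_comm, ← Complex.exp_add, bargmannDensity,
    Complex.real_smul]
  push_cast
  rw [mul_assoc, ← Complex.exp_add, spinorExponent, pow_two (Real.pi : ℂ), mul_inv]
  congr 2
  ring

theorem integrable_bargmann_exp {α : ℂ} (hα : α.re < 1) (p q : Spinor) :
    Integrable (fun w => cexp (spinorExponent α p q w)) bargmann := by
  rw [integrable_bargmann_iff]
  simp_rw [density_smul_exp]
  exact Integrable.fintype_prod (f := fun i (w : ℂ) => (Real.pi : ℂ)⁻¹ *
    cexp (-(1 - α) * (‖w‖ : ℂ) ^ 2 + p i * w + q i * (starRingEnd ℂ) w))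
    (μ := fun _ => volume) fun i =>
    (integrable_complex_gaussian (by simpa using hα) (p i) (q i)).const_mul _

theorem integral_bargmann_exp {α : ℂ} (hα : α.re < 1) (p q : Spinor) :
    ∫ w, cexp (spinorExponent α p q w) ∂bargmann =
      ((1 - α) ^ 2)⁻¹ * cexp ((p 0 * q 0 + p 1 * q 1) / (1 - α)) := by
  rw [integral_bargmann]
  simp_rw [density_smul_exp]
  rw [integral_fintype_prod_volume_eq_prod (f := fun i (w : ℂ) => (Real.pi : ℂ)⁻¹ *
    cexp (-(1 - α) * (‖w‖ : ℂ) ^ 2 + p i * w + q i * (starRingEnd ℂ) w)), Fin.prod_univ_two,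
    integral_const_mul, integral_const_mul, integral_complex_gaussian (by simpa using hα),
    integral_complex_gaussian (by simpa using hα), add_div, Complex.exp_add]
  have hpi : (Real.pi : ℂ) ≠ 0 := by simp [Real.pi_ne_zero]
  have h1 : (1 - α) ≠ 0 := by
    intro h
    have : (1 - α).re = 0 := by rw [h]; simp
    simp at this; linarith
  field_simp

/-- A Gaussian in one spinor is integrable only if its quadratic part is damped. -/
theorem re_lt_one_of_integrable {α : ℂ} {p q : Spinor}
    (h : Integrable (fun w => cexp (spinorExponent α p q w)) bargmann) : α.re < 1 := by
  by_contra hα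
  push Not at hα
  rw [integrable_bargmann_iff] at h
  -- Averaging over `w ↦ -w` removes the effect of the linear part. If `α.re ≥ 1`, the symmetrised
  -- function is bounded below by a positive constant, which is not integrable over the infinite
  -- volume of `ℂ²`.
  have h1 := (h.norm.add h.norm.comp_neg).const_mul (Real.pi ^ 2)
  have h2 : Integrable (fun _ : Spinor => (1 : ℝ)) volume := by
    refine h1.mono' aestronglyMeasurable_const (ae_of_all _ fun w => ?_)
    have hd : bargmannDensity (-w) = bargmannDensity w := by simp [bargmannDensity]
    simp only [Pi.add_apply, norm_smul, hd, Complex.norm_exp, norm_one,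
      Real.norm_of_nonneg (bargmannDensity_nonneg w)]
    set s : ℝ := ‖w 0‖ ^ 2 + ‖w 1‖ ^ 2 with hs
    have hs0 : 0 ≤ s := by positivity
    set r : ℝ := ((p 0 * w 0 + p 1 * w 1) +
      (q 0 * (starRingEnd ℂ) (w 0) + q 1 * (starRingEnd ℂ) (w 1))).re with hr
    have hcast : ((‖w 0‖ : ℂ) ^ 2 + (‖w 1‖ : ℂ) ^ 2) = (s : ℂ) := by
      rw [hs]; push_cast; rfl
    have e1 : (spinorExponent α p q w).re = α.re * s + r := by
      rw [spinorExponent, hcast, add_assoc, Complex.add_re, Complex.re_mul_ofReal, ← hr]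
    have e2 : (spinorExponent α p q (-w)).re = α.re * s - r := by
      have : spinorExponent α p q (-w) = α * s - ((p 0 * w 0 + p 1 * w 1) +
          (q 0 * (starRingEnd ℂ) (w 0) + q 1 * (starRingEnd ℂ) (w 1))) := by
        rw [spinorExponent]
        simp only [Pi.neg_apply, norm_neg, hcast, map_neg]
        ring
      rw [this, Complex.sub_re, Complex.re_mul_ofReal, ← hr]
    have hpi : (Real.pi ^ 2) ≠ 0 := by positivity
    have hd2 : Real.pi ^ 2 * bargmannDensity w = Real.exp (-s) := by
      rw [bargmannDensity, ← hs, mul_inv_cancel_left₀ hpi]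
    rw [e1, e2, ← mul_add, ← mul_assoc, hd2, mul_add, ← Real.exp_add, ← Real.exp_add]
    have h3 : 0 ≤ (α.re - 1) * s := mul_nonneg (by linarith) hs0
    have h4 := Real.add_one_le_exp (-s + (α.re * s + r))
    have h5 := Real.add_one_le_exp (-s + (α.re * s - r))
    nlinarith
  rw [integrable_const_iff] at h2
  rcases h2 with h2 | h2
  · norm_num at h2
  · have := h2.measure_univ_lt_top
    simp at this

instance : IsProbabilityMeasure bargmann := by
  -- The Gaussian formula with trivial exponent computes the total mass.
  have h := integral_bargmann_exp (α := 0) (by simp) 0 0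
  have h0 : ∀ w, spinorExponent 0 0 0 w = 0 := by intro w; simp [spinorExponent]
  simp only [h0] at h
  constructor
  have h1 : (bargmann.real Set.univ : ℂ) = 1 := by simpa using h
  have h2 : bargmann.real Set.univ = 1 := by exact_mod_cast h1
  rw [measureReal_def, ENNReal.toReal_eq_one_iff] at h2
  exact h2

end Bargmann

/-! ### Gaussian integrals over the spinors of all edges. -/

section Wick

open Complex

theorem bracket_swap (z w : Spinor) : bracket w z = -bracket z w := by
  simp only [bracket]; ring

theorem bracket_conjSpinor (z w : Spinor) :
    bracket z (conjSpinor w) = z 0 * (starRingEnd ℂ) (w 0) + z 1 * (starRingEnd ℂ) (w 1) := by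
  simp [bracket, conjSpinor]

/-- The exponent of the Gaussian with coupling matrix `τ`. -/
noncomputable def coupling {E : Type*} [Fintype E] (τ : Matrix (Dart E) (Dart E) ℂ)
    (w : E → Spinor) : ℂ :=
  1 / 2 * ∑ a, ∑ b, τ a b * bracket (OGraph.legSpinor w a) (OGraph.legSpinor w b)

/-- The directed edges of `Fin (n + 1)` other than the two directions of the edge `0`. -/
def succDart {n : ℕ} (d : Dart (Fin n)) : Dart (Fin (n + 1)) := (d.1.succ, d.2)

/-- The coupling that remains when the spinor of the edge `e` is integrated out. -/
noncomputable def contract {E : Type*} (τ : Matrix (Dart E) (Dart E) ℂ) (e : E) :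
    Matrix (Dart E) (Dart E) ℂ :=
  Matrix.of fun a b => τ a b + (-(τ a (e, true) * τ (e, false) b) +
    τ a (e, false) * τ (e, true) b) / (1 + τ (e, false) (e, true))

theorem contract_transpose {E : Type*} {τ : Matrix (Dart E) (Dart E) ℂ}
    (hτ : τ.transpose = -τ) (e : E) : (contract τ e).transpose = -contract τ e := by
  ext a b
  simp only [contract, Matrix.transpose_apply, Matrix.of_apply, Matrix.neg_apply]
  rw [skew_apply hτ a b, skew_apply hτ (e, true) b, skew_apply hτ a (e, false),
    skew_apply hτ a (e, true), skew_apply hτ (e, false) b]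
  ring

/-- Integrating out one edge produces the resolvent of the form of that edge. -/
theorem one_sub_mul_contract {E : Type*} [Fintype E] [DecidableEq E]
    {τ : Matrix (Dart E) (Dart E) ℂ} (hτ : τ.transpose = -τ) {e : E}
    (he : 1 + τ (e, false) (e, true) ≠ 0) :
    (1 - τ * edgeForm {e}) * contract τ e = τ := by
  have h1 := skew_apply hτ (e, false) (e, true)
  ext a b
  rw [sub_mul, one_mul, Matrix.sub_apply, mul_edgeForm_mul_singleton]
  simp only [contract, Matrix.of_apply, skew_self hτ, h1]
  field_simp
  ring

/-- The matrix `1 - τ J` factors into the part of edge `0` and `1 - (contract τ 0) J_R`, with `R`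
the other edges. The first factor gives the square; Sylvester's identity compresses the second to
`R`. -/
theorem det_contract {n : ℕ} {τ : Matrix (Dart (Fin (n + 1))) (Dart (Fin (n + 1))) ℂ}
    (hτ : τ.transpose = -τ) (h0 : 1 + τ (0, false) (0, true) ≠ 0) :
    (1 - τ * edgeForm Finset.univ).det = (1 + τ (0, false) (0, true)) ^ 2 *
      (1 - (contract τ 0).submatrix succDart succDart * edgeForm Finset.univ).det := by
  let R : Finset (Fin (n + 1)) := Finset.univ.erase 0
  have hR : edgeForm (Finset.univ : Finset (Fin (n + 1))) = edgeForm R + edgeForm {0} := by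
    rw [← edgeForm_insert (Finset.notMem_erase _ _), Finset.insert_erase (Finset.mem_univ _)]
  let U : Matrix (Dart (Fin (n + 1))) (Dart (Fin n)) ℂ :=
    Matrix.of fun a b => if a = succDart b then 1 else 0
  have hU : edgeForm R = U * (edgeForm (Finset.univ : Finset (Fin n)) * U.transpose) := by
    ext ⟨a, s⟩ ⟨b, t⟩
    rw [Matrix.mul_apply]
    simp only [edgeForm_mul_apply, U, Matrix.transpose_apply, Matrix.of_apply, succDart,
      Finset.mem_univ, if_true]
    induction a using Fin.cases with
    | zero =>
      rw [Finset.sum_eq_zero]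
      · simp [edgeForm, R]
      · intro c _
        have : ¬ (0 : Fin (n + 1)) = c.1.succ := (Fin.succ_ne_zero _).symm
        simp [this]
    | succ a =>
      rw [Finset.sum_eq_single (a, s)]
      · simp [edgeForm, R, Dart.inv, dartSign]
      · rintro ⟨c, u⟩ _ hc
        have : ¬ (a = c ∧ s = u) := fun h => hc (by rw [h.1, h.2])
        simp [this]
      · simp
  have hUU : U.transpose * (contract τ 0 * U) = (contract τ 0).submatrix succDart succDart := by
    ext a b
    simp [Matrix.mul_apply, U]
  have h1 : 1 - τ * edgeForm Finset.univ =
      (1 - τ * edgeForm {0}) * (1 - contract τ 0 * edgeForm R) := by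
    rw [hR, mul_sub, ← Matrix.mul_assoc (1 - τ * edgeForm {0}), one_sub_mul_contract hτ h0]
    noncomm_ring
  rw [h1, Matrix.det_mul, det_one_sub_mul_edgeForm_singleton hτ, hU, ← Matrix.mul_assoc,
    Matrix.det_one_sub_mul_comm, Matrix.mul_assoc, hUU, Matrix.det_one_sub_mul_comm]

theorem sum_dart_succ {n : ℕ} {M : Type*} [AddCommMonoid M] (g : Dart (Fin (n + 1)) → M) :
    ∑ a, g a = g (0, true) + g (0, false) + ∑ a : Dart (Fin n), g (succDart a) := by
  rw [Fintype.sum_prod_type, Fin.sum_univ_succ, Fintype.sum_prod_type]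
  simp [succDart]

/-- In the spinor of edge `0` the exponent is a damping term, from `[w|w] = |w|²`, plus terms linear
in the spinor and in its conjugate. -/
theorem coupling_cons {n : ℕ} {τ : Matrix (Dart (Fin (n + 1))) (Dart (Fin (n + 1))) ℂ}
    (hτ : τ.transpose = -τ) (w₀ : Spinor) (w : Fin n → Spinor) :
    coupling τ (Fin.cons w₀ w) = coupling (τ.submatrix succDart succDart) w +
      spinorExponent (-τ (0, false) (0, true))
        ![-∑ a, τ (succDart a) (0, true) * OGraph.legSpinor w a 1,
          ∑ a, τ (succDart a) (0, true) * OGraph.legSpinor w a 0]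
        (fun i => ∑ a, τ (succDart a) (0, false) * OGraph.legSpinor w a i) w₀ := by
  have hleg : ∀ a : Dart (Fin n), OGraph.legSpinor (Fin.cons w₀ w : Fin (n + 1) → Spinor)
      (succDart a) = OGraph.legSpinor w a := by
    rintro ⟨a, _ | _⟩ <;> simp [OGraph.legSpinor, succDart]
  have ht : OGraph.legSpinor (Fin.cons w₀ w : Fin (n + 1) → Spinor) (0, true) = w₀ := by
    simp [OGraph.legSpinor]
  have hf : OGraph.legSpinor (Fin.cons w₀ w : Fin (n + 1) → Spinor) (0, false) =
      conjSpinor w₀ := by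
    simp [OGraph.legSpinor]
  have hself : ∀ z : Spinor, bracket z z = 0 := by intro z; simp only [bracket]; ring
  have hn : ∀ z : ℂ, (‖z‖ : ℂ) ^ 2 = z * (starRingEnd ℂ) z := fun z => (Complex.mul_conj' z).symm
  have hA : ∀ w' : Spinor, ∑ a, τ (succDart a) (0, true) * bracket (OGraph.legSpinor w a) w' =
      -(∑ a, τ (succDart a) (0, true) * OGraph.legSpinor w a 1) * w' 0 +
      (∑ a, τ (succDart a) (0, true) * OGraph.legSpinor w a 0) * w' 1 := by
    intro w'
    rw [neg_mul, Finset.sum_mul, Finset.sum_mul, ← Finset.sum_neg_distrib,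
      ← Finset.sum_add_distrib]
    refine Finset.sum_congr rfl fun a _ => ?_
    simp only [bracket]; ring
  have hB : ∑ a, τ (succDart a) (0, false) * bracket (OGraph.legSpinor w a) (conjSpinor w₀) =
      (∑ a, τ (succDart a) (0, false) * OGraph.legSpinor w a 0) * (starRingEnd ℂ) (w₀ 0) +
      (∑ a, τ (succDart a) (0, false) * OGraph.legSpinor w a 1) * (starRingEnd ℂ) (w₀ 1) := by
    rw [Finset.sum_mul, Finset.sum_mul, ← Finset.sum_add_distrib]
    refine Finset.sum_congr rfl fun a _ => ?_
    rw [bracket_conjSpinor]; ring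
  have hsw : ∀ (s : Bool) (w' : Spinor),
      ∑ a, τ (0, s) (succDart a) * bracket w' (OGraph.legSpinor w a) =
      ∑ a, τ (succDart a) (0, s) * bracket (OGraph.legSpinor w a) w' := by
    intro s w'
    refine Finset.sum_congr rfl fun a _ => ?_
    rw [skew_apply hτ (0, s) (succDart a), bracket_swap w' (OGraph.legSpinor w a)]; ring
  have h1 := skew_apply hτ (0, false) (0, true)
  have h2 := bracket_swap w₀ (conjSpinor w₀)
  have h3 := bracket_conjSpinor w₀ w₀
  simp only [coupling, sum_dart_succ, hleg, ht, hf, hself, Finset.sum_add_distrib, hsw, hA, hB,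
    spinorExponent, hn, h1, h2, h3, Matrix.submatrix_apply]
  simp
  ring

/-- The added fraction is the exponent `p · q / (1 - α)` left by the integral over the spinor of
edge `0`. Only its skew part in the two directed edges matters, as the bracket is skew. -/
theorem coupling_contract {n : ℕ} {τ : Matrix (Dart (Fin (n + 1))) (Dart (Fin (n + 1))) ℂ}
    (hτ : τ.transpose = -τ) (w : Fin n → Spinor) :
    coupling ((contract τ 0).submatrix succDart succDart) w =
      coupling (τ.submatrix succDart succDart) w +
      (-(∑ a, τ (succDart a) (0, true) * OGraph.legSpinor w a 1) *
          (∑ a, τ (succDart a) (0, false) * OGraph.legSpinor w a 0) +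
        (∑ a, τ (succDart a) (0, true) * OGraph.legSpinor w a 0) *
          (∑ a, τ (succDart a) (0, false) * OGraph.legSpinor w a 1)) /
        (1 - -τ (0, false) (0, true)) := by
  have h1 : -(∑ a, τ (succDart a) (0, true) * OGraph.legSpinor w a 1) *
          (∑ a, τ (succDart a) (0, false) * OGraph.legSpinor w a 0) +
        (∑ a, τ (succDart a) (0, true) * OGraph.legSpinor w a 0) *
          (∑ a, τ (succDart a) (0, false) * OGraph.legSpinor w a 1) =
      ∑ a, ∑ b, τ (succDart a) (0, true) * τ (succDart b) (0, false) *
        bracket (OGraph.legSpinor w a) (OGraph.legSpinor w b) := by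
    rw [neg_mul, Finset.sum_mul_sum, Finset.sum_mul_sum, ← Finset.sum_neg_distrib,
      ← Finset.sum_add_distrib]
    refine Finset.sum_congr rfl fun a _ => ?_
    rw [← Finset.sum_neg_distrib, ← Finset.sum_add_distrib]
    refine Finset.sum_congr rfl fun b _ => ?_
    simp only [bracket]; ring
  have h2 : ∑ a, ∑ b, τ (succDart a) (0, true) * τ (succDart b) (0, false) *
        bracket (OGraph.legSpinor w a) (OGraph.legSpinor w b) =
      ∑ a, ∑ b, -(τ (succDart b) (0, true) * τ (succDart a) (0, false) *
        bracket (OGraph.legSpinor w a) (OGraph.legSpinor w b)) := by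
    rw [Finset.sum_comm]
    refine Finset.sum_congr rfl fun a _ => Finset.sum_congr rfl fun b _ => ?_
    rw [bracket_swap (OGraph.legSpinor w a) (OGraph.legSpinor w b)]; ring
  have h3 : ∑ a, ∑ b, τ (succDart a) (0, true) * τ (succDart b) (0, false) *
        bracket (OGraph.legSpinor w a) (OGraph.legSpinor w b) =
      1 / 2 * ∑ a, ∑ b, (-(τ (succDart a) (0, true) * τ (0, false) (succDart b)) +
        τ (succDart a) (0, false) * τ (0, true) (succDart b)) *
        bracket (OGraph.legSpinor w a) (OGraph.legSpinor w b) := by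
    have h4 : ∑ a, ∑ b, (-(τ (succDart a) (0, true) * τ (0, false) (succDart b)) +
        τ (succDart a) (0, false) * τ (0, true) (succDart b)) *
        bracket (OGraph.legSpinor w a) (OGraph.legSpinor w b) =
        ∑ a, ∑ b, τ (succDart a) (0, true) * τ (succDart b) (0, false) *
        bracket (OGraph.legSpinor w a) (OGraph.legSpinor w b) +
        ∑ a, ∑ b, -(τ (succDart b) (0, true) * τ (succDart a) (0, false) *
        bracket (OGraph.legSpinor w a) (OGraph.legSpinor w b)) := by
      rw [← Finset.sum_add_distrib]
      refine Finset.sum_congr rfl fun a _ => ?_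
      rw [← Finset.sum_add_distrib]
      refine Finset.sum_congr rfl fun b _ => ?_
      rw [skew_apply hτ (0, false) (succDart b), skew_apply hτ (0, true) (succDart b)]; ring
    rw [h4, ← h2]; ring
  rw [h1, h3, sub_neg_eq_add, mul_div_assoc, coupling, coupling, ← mul_add, Finset.sum_div,
    ← Finset.sum_add_distrib]
  congr 1
  refine Finset.sum_congr rfl fun a _ => ?_
  rw [Finset.sum_div, ← Finset.sum_add_distrib]
  refine Finset.sum_congr rfl fun b _ => ?_
  simp only [contract, Matrix.submatrix_apply, Matrix.of_apply]
  ring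

theorem integral_exp_coupling_fin (n : ℕ) (τ : Matrix (Dart (Fin n)) (Dart (Fin n)) ℂ)
    (hτ : τ.transpose = -τ)
    (hint : Integrable (fun w => cexp (coupling τ w)) (Measure.pi fun _ => bargmann)) :
    (1 - τ * edgeForm Finset.univ).det ≠ 0 ∧
      ∫ w, cexp (coupling τ w) ∂(Measure.pi fun _ => bargmann) =
        1 / (1 - τ * edgeForm Finset.univ).det := by
  induction n with
  | zero =>
    have h : ∀ w : Fin 0 → Spinor, coupling τ w = 0 := fun w => by simp [coupling]
    simp [h, Matrix.det_isEmpty]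
  | succ n ih =>
    set μ : Measure (Fin n → Spinor) := Measure.pi fun _ => bargmann with hμ
    have hmp := (measurePreserving_piFinSuccAbove (fun _ : Fin (n + 1) => bargmann) 0).symm
    have hcons : ∀ x : Spinor × (Fin n → Spinor),
        (MeasurableEquiv.piFinSuccAbove (fun _ : Fin (n + 1) => Spinor) 0).symm x =
          Fin.cons x.1 x.2 := fun x => by
      simp [MeasurableEquiv.piFinSuccAbove, Fin.insertNthEquiv]
    have hint' := (hmp.integrable_comp_emb (MeasurableEquiv.measurableEmbedding _)).mpr hint
    rw [← hmp.integral_comp' (f := (MeasurableEquiv.piFinSuccAbove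
      (fun _ : Fin (n + 1) => Spinor) 0).symm)]
    simp only [Function.comp_def, hcons, coupling_cons hτ, Complex.exp_add] at hint' ⊢
    have hslice := hint'.swap.prod_right_ae
    -- By Fubini almost every slice in the first spinor is integrable; one such slice forces the
    -- damping.
    have hre : (-τ (0, false) (0, true)).re < 1 := by
      obtain ⟨w, hw⟩ := hslice.exists
      have hw' := hw.const_mul (cexp (coupling (τ.submatrix succDart succDart) w))⁻¹
      simp only [Function.comp_def, Prod.swap_prod_mk,
        inv_mul_cancel_left₀ (Complex.exp_ne_zero _)] at hw'
      exact re_lt_one_of_integrable hw'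
    have hκ : 1 + τ (0, false) (0, true) ≠ 0 := by
      intro h
      have := congrArg Complex.re h
      simp at this hre; linarith
    have hinner : ∀ w : Fin n → Spinor,
        ∫ w₀, cexp (coupling (τ.submatrix succDart succDart) w) *
          cexp (spinorExponent (-τ (0, false) (0, true))
            ![-∑ a, τ (succDart a) (0, true) * OGraph.legSpinor w a 1,
              ∑ a, τ (succDart a) (0, true) * OGraph.legSpinor w a 0]
            (fun i => ∑ a, τ (succDart a) (0, false) * OGraph.legSpinor w a i) w₀) ∂bargmann =
        ((1 + τ (0, false) (0, true)) ^ 2)⁻¹ *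
          cexp (coupling ((contract τ 0).submatrix succDart succDart) w) := by
      intro w
      rw [integral_const_mul, integral_bargmann_exp hre, coupling_contract hτ, Complex.exp_add,
        sub_neg_eq_add]
      simp only [Matrix.cons_val_zero, Matrix.cons_val_one]
      ring
    -- Fubini also makes the contracted Gaussian integrable, as the induction hypothesis requires.
    have hint2 := hint'.integral_prod_right
    simp only [hinner] at hint2
    have hint3 := hint2.const_mul ((1 + τ (0, false) (0, true)) ^ 2)
    simp only [mul_inv_cancel_left₀ (pow_ne_zero 2 hκ)] at hint3
    have hsk : ((contract τ 0).submatrix succDart succDart).transpose =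
        -(contract τ 0).submatrix (succDart (n := n)) succDart := by
      rw [Matrix.transpose_submatrix, contract_transpose hτ]; rfl
    obtain ⟨h1, h2⟩ := ih _ hsk hint3
    rw [det_contract hτ hκ]
    refine ⟨mul_ne_zero (pow_ne_zero 2 hκ) h1, ?_⟩
    rw [integral_prod_symm _ hint']
    simp only [hinner]
    rw [integral_const_mul, h2]
    field_simp

/-- The Gaussian integral with coupling matrix `τ`, wherever it converges. -/
theorem integral_exp_coupling {E : Type*} [Fintype E] [DecidableEq E]
    {τ : Matrix (Dart E) (Dart E) ℂ} (hτ : τ.transpose = -τ)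
    (hint : Integrable (fun w => cexp (coupling τ w)) (Measure.pi fun _ : E => bargmann)) :
    (1 - τ * edgeForm Finset.univ).det ≠ 0 ∧
      ∫ w, cexp (coupling τ w) ∂(Measure.pi fun _ : E => bargmann) =
        1 / (1 - τ * edgeForm Finset.univ).det := by
  let φ : E ≃ Fin (Fintype.card E) := Fintype.equivFin E
  let ψ : Dart (Fin (Fintype.card E)) ≃ Dart E := φ.symm.prodCongr (Equiv.refl _)
  have hmp := measurePreserving_piCongrLeft (fun _ : E => bargmann) φ.symm
  have hc : ∀ u : Fin (Fintype.card E) → Spinor,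
      coupling τ (MeasurableEquiv.piCongrLeft (fun _ : E => Spinor) φ.symm u) =
        coupling (τ.submatrix ψ ψ) u := by
    intro u
    have hu : ∀ i, MeasurableEquiv.piCongrLeft (fun _ : E => Spinor) φ.symm u (φ.symm i) = u i :=
      fun i => MeasurableEquiv.piCongrLeft_apply_apply (β := fun _ : E => Spinor) φ.symm u i
    have hl : ∀ d, OGraph.legSpinor
        (MeasurableEquiv.piCongrLeft (fun _ : E => Spinor) φ.symm u) (ψ d) =
        OGraph.legSpinor u d := by
      rintro ⟨i, s⟩
      simp only [OGraph.legSpinor, ψ, Equiv.prodCongr_apply, Prod.map, hu, Equiv.refl_apply]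
    rw [coupling, coupling, ← Equiv.sum_comp ψ]
    congr 1
    refine Finset.sum_congr rfl fun a _ => ?_
    rw [← Equiv.sum_comp ψ]
    simp only [hl, Matrix.submatrix_apply]
  have hdet : (1 - τ * edgeForm Finset.univ).det =
      (1 - τ.submatrix ψ ψ * edgeForm Finset.univ).det := by
    have hJ : (edgeForm (Finset.univ : Finset E)).submatrix ψ ψ = edgeForm Finset.univ := by
      ext ⟨a, s⟩ ⟨b, t⟩
      simp [edgeForm, ψ, Dart.inv, dartSign]
    have h1 : (1 - τ * edgeForm Finset.univ).submatrix ψ ψ =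
        (1 : Matrix (Dart E) (Dart E) ℂ).submatrix ψ ψ -
          (τ * edgeForm Finset.univ).submatrix ψ ψ := rfl
    rw [← Matrix.det_submatrix_equiv_self ψ, h1, Matrix.submatrix_one_equiv,
      ← Matrix.submatrix_mul_equiv τ _ ψ ψ ψ, hJ]
  have hint' := (hmp.integrable_comp_emb (MeasurableEquiv.measurableEmbedding _)).mpr hint
  rw [← hmp.integral_comp', hdet]
  simp only [Function.comp_def, hc] at hint' ⊢
  exact integral_exp_coupling_fin _ _ (by rw [Matrix.transpose_submatrix, hτ]; rfl) hint'

/-- The squared Euclidean norm of a spinor. -/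
noncomputable def spinorNormSq (w : Spinor) : ℝ := ‖w 0‖ ^ 2 + ‖w 1‖ ^ 2

theorem spinorNormSq_nonneg (w : Spinor) : 0 ≤ spinorNormSq w := by
  unfold spinorNormSq; positivity

theorem norm_bracket_le (z w : Spinor) :
    ‖bracket z w‖ ≤ (spinorNormSq z + spinorNormSq w) / 2 := by
  refine (norm_sub_le _ _).trans ?_
  rw [norm_mul, norm_mul, spinorNormSq, spinorNormSq]
  nlinarith [sq_nonneg (‖z 0‖ - ‖w 1‖), sq_nonneg (‖z 1‖ - ‖w 0‖)]

theorem spinorNormSq_legSpinor {E : Type*} (w : E → Spinor) (d : Dart E) :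
    spinorNormSq (OGraph.legSpinor w d) = spinorNormSq (w d.1) := by
  rcases d with ⟨e, _ | _⟩
  · simp [OGraph.legSpinor, spinorNormSq, conjSpinor, add_comm]
  · simp [OGraph.legSpinor]

theorem norm_coupling_le {E : Type*} [Fintype E] {τ : Matrix (Dart E) (Dart E) ℂ} {ε : ℝ}
    (hτ : ∀ a b, ‖τ a b‖ ≤ ε) (w : E → Spinor) :
    ‖coupling τ w‖ ≤ 2 * ε * Fintype.card E * ∑ e, spinorNormSq (w e) := by
  have h1 : ∀ a b, ‖τ a b * bracket (OGraph.legSpinor w a) (OGraph.legSpinor w b)‖ ≤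
      ε / 2 * (spinorNormSq (w a.1) + spinorNormSq (w b.1)) := by
    intro a b
    rw [norm_mul, ← spinorNormSq_legSpinor w a, ← spinorNormSq_legSpinor w b]
    calc _ ≤ ε * ((spinorNormSq (OGraph.legSpinor w a) + spinorNormSq (OGraph.legSpinor w b)) / 2)
          := mul_le_mul (hτ a b) (norm_bracket_le _ _) (norm_nonneg _)
            ((norm_nonneg _).trans (hτ a b))
      _ = _ := by ring
  have h2 : ∑ a : Dart E, ∑ b : Dart E, ε / 2 * (spinorNormSq (w a.1) + spinorNormSq (w b.1)) =
      4 * ε * Fintype.card E * ∑ e, spinorNormSq (w e) := by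
    simp only [← Finset.mul_sum, Finset.sum_add_distrib, Finset.sum_const, Finset.card_univ,
      Fintype.card_prod, Fintype.card_bool, Fintype.sum_prod_type, nsmul_eq_mul]
    push_cast
    ring
  rw [coupling, norm_mul]
  have h3 := (norm_sum_le Finset.univ fun a => ∑ b, τ a b *
    bracket (OGraph.legSpinor w a) (OGraph.legSpinor w b)).trans
    (Finset.sum_le_sum fun a _ => (norm_sum_le _ _).trans (Finset.sum_le_sum fun b _ => h1 a b))
  rw [h2] at h3
  norm_num
  linarith

theorem integrable_exp_half_normSq {E : Type*} [Fintype E] :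
    Integrable (fun w : E → Spinor => Real.exp (1 / 2 * ∑ e, spinorNormSq (w e)))
      (Measure.pi fun _ => bargmann) := by
  have h1 : Integrable (fun w : Spinor => Real.exp (1 / 2 * spinorNormSq w)) bargmann := by
    refine ((integrable_bargmann_exp (α := 1 / 2) (by norm_num) 0 0).norm).congr
      (ae_of_all _ fun w => ?_)
    have : spinorExponent (1 / 2) 0 0 w = ((1 / 2 * spinorNormSq w : ℝ) : ℂ) := by
      simp [spinorExponent, spinorNormSq]
    simp only [this, Complex.norm_exp, Complex.ofReal_re]
  have h2 := Integrable.fintype_prod (f := fun (_ : E) (w : Spinor) =>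
    Real.exp (1 / 2 * spinorNormSq w)) (μ := fun _ => bargmann) fun _ => h1
  refine h2.congr (ae_of_all _ fun w => ?_)
  simp only [Finset.mul_sum, Real.exp_sum]

theorem continuous_legSpinor {E : Type*} (d : Dart E) :
    Continuous fun w : E → Spinor => OGraph.legSpinor w d := by
  rcases d with ⟨e, _ | _⟩
  · simp only [OGraph.legSpinor, conjSpinor]
    refine continuous_pi fun i => ?_
    fin_cases i
    · exact (Complex.continuous_conj.comp
        ((continuous_apply (1 : Fin 2)).comp (continuous_apply e))).neg
    · exact Complex.continuous_conj.comp ((continuous_apply (0 : Fin 2)).comp (continuous_apply e))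
  · simpa [OGraph.legSpinor] using continuous_apply e

theorem continuous_bracket {X : Type*} [TopologicalSpace X] {f g : X → Spinor}
    (hf : Continuous f) (hg : Continuous g) : Continuous fun x => bracket (f x) (g x) := by
  unfold bracket
  fun_prop

theorem continuous_coupling {E : Type*} [Fintype E] (τ : Matrix (Dart E) (Dart E) ℂ) :
    Continuous (coupling τ) := by
  unfold coupling
  refine continuous_const.mul (continuous_finsetSum _ fun a _ => continuous_finsetSum _ fun b _ =>
    continuous_const.mul (continuous_bracket (continuous_legSpinor a) (continuous_legSpinor b)))

/-- Small couplings bound the exponent by half the squared norm, which the Gaussian weight still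
dominates. -/
theorem integrable_exp_coupling {E : Type*} [Fintype E] {τ : Matrix (Dart E) (Dart E) ℂ} {ε : ℝ}
    (hτ : ∀ a b, ‖τ a b‖ ≤ ε) (hε : 2 * ε * Fintype.card E ≤ 1 / 2) :
    Integrable (fun w => cexp (coupling τ w)) (Measure.pi fun _ : E => bargmann) := by
  refine integrable_exp_half_normSq.mono' ((Complex.continuous_exp.comp
    (continuous_coupling τ)).aestronglyMeasurable) (ae_of_all _ fun w => ?_)
  rw [Complex.norm_exp, Real.exp_le_exp]
  refine (Complex.re_le_norm _).trans ((norm_coupling_le hτ w).trans ?_)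
  exact mul_le_mul_of_nonneg_right hε (Finset.sum_nonneg fun e _ => spinorNormSq_nonneg _)

theorem genIntegrand_eq {V E : Type*} [Fintype V] [Fintype E] (Γ : OGraph V E) (T : Param E)
    (w : E → Spinor) : Γ.genIntegrand T w = cexp (coupling (Γ.localMatrix T) w) := by
  classical
  simp only [OGraph.genIntegrand, OGraph.vertexFun]
  rw [← Complex.exp_sum, ← Finset.mul_sum, coupling]
  congr 2
  simp only [Finset.sum_filter]
  rw [Finset.sum_comm]
  refine Finset.sum_congr rfl fun a _ => ?_
  rw [Finset.sum_ite_eq]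
  simp [OGraph.localMatrix, eq_comm]

end Wick

end SpinNetwork

namespace SpinNetwork

/-! ### Radial moments of the Bargmann measure. -/

section RadialMoment

theorem integral_radial_spinor : ∃ c : ℝ, ∀ g : ℝ → ℝ,
    ∫ u : Spinor, g (Real.sqrt (spinorNormSq u)) = c * ∫ y in Set.Ioi (0 : ℝ), y ^ 3 * g y := by
  let L : Spinor ≃L[ℝ] EuclideanSpace ℂ (Fin 2) :=
    (PiLp.continuousLinearEquiv 2 ℝ fun _ : Fin 2 => ℂ).symm
  let ν : Measure (EuclideanSpace ℂ (Fin 2)) := Measure.map L volume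
  have hν : ν.IsAddHaarMeasure := L.isAddHaarMeasure_map volume
  have hdim : Module.finrank ℝ (EuclideanSpace ℂ (Fin 2)) = 4 := by
    rw [finrank_real_of_complex, finrank_euclideanSpace]; simp
  refine ⟨4 * ν.real (Metric.ball 0 1), fun g => ?_⟩
  have h1 := integral_fun_norm_addHaar ν g
  have hmp : MeasurePreserving L volume ν := ⟨L.continuous.measurable, rfl⟩
  rw [← hmp.integral_comp L.toHomeomorph.measurableEmbedding, hdim] at h1
  have hL : ∀ u : Spinor, ‖L u‖ = Real.sqrt (spinorNormSq u) := by
    intro u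
    rw [EuclideanSpace.norm_eq, Fin.sum_univ_two]
    rfl
  simp only [hL] at h1
  rw [h1]
  simp [mul_assoc]

theorem integral_bargmann_norm_pow (N : ℕ) :
    ∫ u : Spinor, Real.sqrt (spinorNormSq u) ^ N ∂bargmann = Real.Gamma ((N : ℝ) / 2 + 2) := by
  obtain ⟨c, hc⟩ := integral_radial_spinor
  have h1 : ∀ N : ℕ, ∫ u : Spinor, Real.sqrt (spinorNormSq u) ^ N ∂bargmann =
      (Real.pi ^ 2)⁻¹ * c * (1 / 2) * Real.Gamma ((N : ℝ) / 2 + 2) := by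
    intro N
    rw [integral_bargmann]
    have h2 : ∀ u : Spinor, bargmannDensity u • Real.sqrt (spinorNormSq u) ^ N =
        (fun y : ℝ => (Real.pi ^ 2)⁻¹ * Real.exp (-y ^ 2) * y ^ N)
          (Real.sqrt (spinorNormSq u)) := by
      intro u
      simp only [Real.sq_sqrt (spinorNormSq_nonneg u)]
      rfl
    simp only [h2]
    rw [hc (fun y : ℝ => (Real.pi ^ 2)⁻¹ * Real.exp (-y ^ 2) * y ^ N)]
    have h3 : ∫ y in Set.Ioi (0 : ℝ), y ^ 3 * ((Real.pi ^ 2)⁻¹ * Real.exp (-y ^ 2) * y ^ N) =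
        (Real.pi ^ 2)⁻¹ * ∫ y in Set.Ioi (0 : ℝ), y ^ ((N : ℝ) + 3) * Real.exp (-y ^ (2 : ℝ)) := by
      rw [← integral_const_mul]
      refine setIntegral_congr_fun measurableSet_Ioi fun y hy => ?_
      have h4 : y ^ ((N : ℝ) + 3) = y ^ N * y ^ 3 := by
        rw [Real.rpow_add hy, Real.rpow_natCast]
        norm_cast
      have h5 : y ^ (2 : ℝ) = y ^ 2 := by norm_cast
      simp only [h4, h5]
      ring
    rw [h3, integral_rpow_mul_exp_neg_rpow (by norm_num) 
      (by linarith [N.cast_nonneg (α := ℝ)])]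
    have h6 : ((N : ℝ) + 3 + 1) / 2 = (N : ℝ) / 2 + 2 := by ring
    rw [h6]; ring
  -- The unspecified constant of polar coordinates is fixed by the case `N = 0`: total mass one and
  -- `Γ(2) = 1`.
  have h0 := h1 0
  have hc1 : 1 = (Real.pi ^ 2)⁻¹ * c * (1 / 2) := by simpa using h0
  rw [h1 N]
  have : (Real.pi ^ 2)⁻¹ * c * (1 / 2) = 1 := hc1.symm
  rw [this, one_mul]

theorem integrable_bargmann_norm_pow (N : ℕ) :
    Integrable (fun u : Spinor => Real.sqrt (spinorNormSq u) ^ N) bargmann := by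
  by_contra h
  have h1 := integral_bargmann_norm_pow N
  -- A function that is not integrable has integral zero by convention, whereas the value found is
  -- positive.
  rw [integral_undef h] at h1
  exact (Real.Gamma_pos_of_pos (by positivity)).ne h1

end RadialMoment

/-! ### `SU(2)`, its action on spinors and the polar decomposition. -/

section SpecialUnitary

open Matrix

theorem su2_apply_one (h : SU2) :
    h.1 1 0 = -(starRingEnd ℂ) (h.1 0 1) ∧ h.1 1 1 = (starRingEnd ℂ) (h.1 0 0) := by
  have hu := (Matrix.mem_specialUnitaryGroup_iff.mp h.2).1
  have hd := (Matrix.mem_specialUnitaryGroup_iff.mp h.2).2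
  have h1 : star h.1 * h.1 = 1 := (Unitary.mem_iff.mp hu).1
  have h2 : h.1 * h.1.adjugate = 1 := by rw [Matrix.mul_adjugate, hd, one_smul]
  have h3 : star h.1 = h.1.adjugate := left_inv_eq_right_inv h1 h2
  rw [Matrix.adjugate_fin_two] at h3
  have h4 := congrFun (congrFun h3 1) 0
  have h5 := congrFun (congrFun h3 0) 0
  simp [Matrix.star_apply] at h4 h5
  constructor
  · rw [h4]; simp
  · rw [h5]

/-- The matrix with rows `u` and `|u]`. -/
noncomputable def spinorMatrix (u : Spinor) : Matrix (Fin 2) (Fin 2) ℂ :=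
  Matrix.of ![u, conjSpinor u]

theorem spinorMatrix_vecMul (u : Spinor) (h : SU2) :
    spinorMatrix (u ᵥ* h.1) = spinorMatrix u * h.1 := by
  obtain ⟨h1, h2⟩ := su2_apply_one h
  ext i j
  fin_cases i <;> fin_cases j <;>
    simp [spinorMatrix, Matrix.mul_apply, Matrix.vecMul, dotProduct, Fin.sum_univ_two, conjSpinor,
      h1, h2]
  ring

theorem spinorNormSq_eq (u : Spinor) :
    (spinorNormSq u : ℂ) = u 0 * (starRingEnd ℂ) (u 0) + u 1 * (starRingEnd ℂ) (u 1) := by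
  rw [Complex.mul_conj', Complex.mul_conj', spinorNormSq]
  push_cast; rfl

theorem spinorMatrix_mul_conjTranspose (u : Spinor) :
    spinorMatrix u * (spinorMatrix u)ᴴ = (spinorNormSq u : ℂ) • 1 := by
  rw [spinorNormSq_eq]
  ext i j
  fin_cases i <;> fin_cases j <;>
    simp [spinorMatrix, Matrix.mul_apply, Fin.sum_univ_two, conjSpinor,
      Matrix.conjTranspose_apply] <;> ring

theorem det_spinorMatrix (u : Spinor) : (spinorMatrix u).det = spinorNormSq u := by
  rw [spinorNormSq_eq, Matrix.det_fin_two]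
  simp [spinorMatrix, conjSpinor]

theorem spinorNormSq_vecMul (u : Spinor) (h : SU2) :
    spinorNormSq (u ᵥ* h.1) = spinorNormSq u := by
  have h1 := det_spinorMatrix (u ᵥ* h.1)
  rw [spinorMatrix_vecMul, Matrix.det_mul, det_spinorMatrix,
    (Matrix.mem_specialUnitaryGroup_iff.mp h.2).2, mul_one] at h1
  exact_mod_cast h1.symm

/-- The polar decomposition of the matrix of a spinor. -/
theorem exists_su2_spinorMatrix (u : Spinor) :
    ∃ N : SU2, spinorMatrix u = (Real.sqrt (spinorNormSq u) : ℂ) • N.1 := by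
  set r := Real.sqrt (spinorNormSq u) with hr
  have hr2 : (r : ℂ) ^ 2 = spinorNormSq u := by
    rw [← Complex.ofReal_pow, hr, Real.sq_sqrt (spinorNormSq_nonneg u)]
  by_cases h0 : r = 0
  -- For the zero spinor the unitary factor is arbitrary.
  · refine ⟨1, ?_⟩
    have hs : spinorNormSq u = 0 := by
      have := hr2; rw [h0] at this; simpa using this.symm
    unfold spinorNormSq at hs
    have h1 : ‖u 0‖ ^ 2 = 0 := by nlinarith [sq_nonneg ‖u 0‖, sq_nonneg ‖u 1‖]
    have h2 : ‖u 1‖ ^ 2 = 0 := by nlinarith [sq_nonneg ‖u 0‖, sq_nonneg ‖u 1‖]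
    have h1' : u 0 = 0 := by simpa using h1
    have h2' : u 1 = 0 := by simpa using h2
    rw [h0]
    ext i j
    fin_cases i <;> fin_cases j <;> simp [spinorMatrix, conjSpinor, h1', h2']
  · have h0' : (r : ℂ) ≠ 0 := by exact_mod_cast h0
    have hmul : ((r : ℂ)⁻¹ • spinorMatrix u) * star ((r : ℂ)⁻¹ • spinorMatrix u) = 1 := by
      rw [star_smul, Matrix.star_eq_conjTranspose, Matrix.smul_mul, Matrix.mul_smul,
        spinorMatrix_mul_conjTranspose, smul_smul, smul_smul, ← hr2]
      have : (r : ℂ)⁻¹ * (star (r : ℂ)⁻¹ * (r : ℂ) ^ 2) = 1 := by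
        simp; field_simp
      rw [← mul_assoc] at this
      rw [this, one_smul]
    refine ⟨⟨(r : ℂ)⁻¹ • spinorMatrix u, ?_⟩, ?_⟩
    · rw [Matrix.mem_specialUnitaryGroup_iff]
      refine ⟨Unitary.mem_iff.mpr ⟨mul_eq_one_comm.mp hmul, hmul⟩, ?_⟩
      rw [Matrix.det_smul, det_spinorMatrix, ← hr2]
      simp; field_simp
    · rw [smul_smul, mul_inv_cancel₀ h0', one_smul]

instance : SecondCountableTopology SU2 :=
  inferInstanceAs (SecondCountableTopology {A : Fin 2 → Fin 2 → ℂ // A ∈ Matrix.specialUnitaryGroup (Fin 2) ℂ})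

instance : IsProbabilityMeasure haarSU2 := by
  constructor
  have := Measure.haarMeasure_self (K₀ := (⊤ : TopologicalSpace.PositiveCompacts SU2))
  simpa [haarSU2] using this

instance : haarSU2.IsMulLeftInvariant := by
  unfold haarSU2; infer_instance

theorem measurePreserving_vecMul (h : SU2) :
    MeasurePreserving (fun u : Spinor => u ᵥ* h.1) bargmann bargmann := by
  let f : Spinor →ₗ[ℝ] Spinor := (Matrix.vecMulLinear h.1).restrictScalars ℝ
  have hf : ⇑f = fun u : Spinor => u ᵥ* h.1 := rfl
  have hcont : Continuous f := f.continuous_of_finiteDimensional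
  have hinj : Function.Injective f := by
    intro u u' huu
    have h1 : (u ᵥ* h.1) ᵥ* (h⁻¹).1 = (u' ᵥ* h.1) ᵥ* (h⁻¹).1 := by
      rw [show u ᵥ* h.1 = u' ᵥ* h.1 from huu]
    have h2 : h.1 * (h⁻¹).1 = 1 := by
      have := congrArg Subtype.val (mul_inv_cancel h)
      exact this
    simpa [Matrix.vecMul_vecMul, h2] using h1
  have hdet : LinearMap.det f ≠ 0 :=
    (LinearEquiv.isUnit_det' (LinearEquiv.ofInjectiveEndo f hinj)).ne_zero
  have hvol := Measure.map_linearMap_addHaar_eq_smul_addHaar (volume : Measure Spinor) hdet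
  set c := ENNReal.ofReal |(LinearMap.det f)⁻¹|
  have hmap : Measure.map f bargmann = c • bargmann := by
    have hρ : Measurable fun w => ENNReal.ofReal (bargmannDensity w) :=
      continuous_bargmannDensity.measurable.ennreal_ofReal
    ext s hs
    rw [Measure.map_apply hcont.measurable hs, bargmann_eq,
      withDensity_apply _ (hcont.measurable hs), Measure.smul_apply, withDensity_apply _ hs]
    have h1 : ∀ u, bargmannDensity u = bargmannDensity (f u) := by
      intro u
      have : spinorNormSq (f u) = spinorNormSq u := spinorNormSq_vecMul u h
      change (Real.pi ^ 2)⁻¹ * Real.exp (-spinorNormSq u) =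
        (Real.pi ^ 2)⁻¹ * Real.exp (-spinorNormSq (f u))
      rw [this]
    have h2 : ∫⁻ u in f ⁻¹' s, ENNReal.ofReal (bargmannDensity u) =
        ∫⁻ u in f ⁻¹' s, ENNReal.ofReal (bargmannDensity (f u)) := by
      simp only [← h1]
    rw [h2, ← setLIntegral_map hs hρ hcont.measurable, hvol, Measure.restrict_smul,
      lintegral_smul_measure]
  -- The linear map scales Lebesgue measure by a constant and fixes the density. Since the total
  -- mass is one on both sides, the constant is `1`.
  have hc : c = 1 := by
    have h1 := congrArg (fun m : Measure Spinor => m Set.univ) hmap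
    simp only [Measure.map_apply hcont.measurable MeasurableSet.univ, Set.preimage_univ,
      measure_univ, Measure.smul_apply, smul_eq_mul, mul_one] at h1
    exact h1.symm
  refine ⟨hf ▸ hcont.measurable, ?_⟩
  rw [← hf, hmap, hc, one_smul]

end SpecialUnitary

end SpinNetwork

namespace SpinNetwork

open Matrix

/-! ### Each term of the sum over spins as a Gaussian integral. -/

section Averaging

variable {V E : Type*} (Γ : OGraph V E)

/-- The edge amplitude as a function of matrices at the two ends of the edge. -/
noncomputable def edgeAmp (z : Dart E → Spinor) (M : V → Matrix (Fin 2) (Fin 2) ℂ) (e : E) : ℂ :=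
  bracket (z (e, true)) ((M (Γ.src e) * (M (Γ.tgt e))ᴴ) *ᵥ z (e, false))

variable [Fintype E]

/-- The integrand of the amplitude as a function of matrices at the vertices. -/
noncomputable def matrixAmp (n : E → ℕ) (z : Dart E → Spinor)
    (M : V → Matrix (Fin 2) (Fin 2) ℂ) : ℂ :=
  ∏ e, edgeAmp Γ z M e ^ n e / ((n e).factorial : ℂ)

open scoped Classical in
/-- The valence of a vertex with respect to the multiplicities `n`. -/
noncomputable def valence (n : E → ℕ) (v : V) : ℕ :=
  ∑ e : E with Γ.src e = v, n e + ∑ e : E with Γ.tgt e = v, n e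

theorem valence_div_two (n : E → ℕ) (v : V) :
    (valence Γ n v : ℝ) / 2 = Γ.vertexSpin n v := by
  simp only [valence, OGraph.vertexSpin]
  push_cast
  rw [add_div, Finset.sum_div, Finset.sum_div]

theorem continuous_matrixAmp {X : Type*} [TopologicalSpace X] (n : E → ℕ) (z : Dart E → Spinor)
    {M : X → V → Matrix (Fin 2) (Fin 2) ℂ} (hM : ∀ v, Continuous fun x => M x v) :
    Continuous fun x => matrixAmp Γ n z (M x) := by
  unfold matrixAmp
  refine continuous_finsetProd _ fun e _ => Continuous.div_const (Continuous.pow ?_ _) _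
  unfold edgeAmp
  exact continuous_bracket continuous_const
    (((hM _).mul (hM _).matrix_conjTranspose).matrix_mulVec continuous_const)

theorem continuous_spinorMatrix : Continuous spinorMatrix := by
  unfold spinorMatrix conjSpinor
  refine continuous_matrix fun i j => ?_
  fin_cases i <;> fin_cases j
  · exact continuous_apply 0
  · exact continuous_apply 1
  · exact (Complex.continuous_conj.comp (continuous_apply 1)).neg
  · exact Complex.continuous_conj.comp (continuous_apply 0)

theorem exists_bound_matrixAmp (n : E → ℕ) (z : Dart E → Spinor) :
    ∃ C, ∀ g : V → SU2, ‖matrixAmp Γ n z fun v => (g v).1‖ ≤ C := by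
  have hc : Continuous fun g : V → SU2 => matrixAmp Γ n z fun v => (g v).1 :=
    continuous_matrixAmp Γ n z fun v => continuous_subtype_val.comp (continuous_apply v)
  obtain ⟨C, hC⟩ := isCompact_univ.exists_bound_of_continuousOn hc.continuousOn
  exact ⟨C, fun g => hC g (Set.mem_univ _)⟩

variable [Fintype V]

theorem spinAmp_eq (n : E → ℕ) (z : Dart E → Spinor) :
    Γ.spinAmp n z = ∫ g : V → SU2, matrixAmp Γ n z (fun v => (g v).1)
      ∂(Measure.pi fun _ : V => haarSU2) := rfl

/-- Writing the inverse as a conjugate transpose makes the amplitude a polynomial in matrix entries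
and their conjugates. Its degree at `v` is `valence`, to which an edge from `v` to itself
contributes twice. -/
theorem matrixAmp_smul (n : E → ℕ) (z : Dart E → Spinor) (r : V → ℝ)
    (M : V → Matrix (Fin 2) (Fin 2) ℂ) :
    matrixAmp Γ n z (fun v => (r v : ℂ) • M v) =
      ((∏ v, r v ^ valence Γ n v : ℝ) : ℂ) * matrixAmp Γ n z M := by
  classical
  have h1 : ∀ e, edgeAmp Γ z (fun v => (r v : ℂ) • M v) e =
      ((r (Γ.src e) : ℂ) * r (Γ.tgt e)) * edgeAmp Γ z M e := by
    intro e
    rw [edgeAmp, edgeAmp, Matrix.conjTranspose_smul, Matrix.smul_mul, Matrix.mul_smul,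
      Matrix.smul_mulVec, Matrix.smul_mulVec]
    simp [bracket]
    ring
  have h2 : ∀ f : E → V, ∏ v, r v ^ (∑ e : E with f e = v, n e) = ∏ e, r (f e) ^ n e := by
    intro f
    rw [← Finset.prod_fiberwise Finset.univ f (fun e => r (f e) ^ n e)]
    refine Finset.prod_congr rfl fun v _ => ?_
    rw [← Finset.prod_pow_eq_pow_sum]
    refine Finset.prod_congr rfl fun e he => ?_
    rw [(Finset.mem_filter.mp he).2]
  have h3 : ∏ v, r v ^ valence Γ n v = ∏ e, (r (Γ.src e) * r (Γ.tgt e)) ^ n e := by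
    simp only [valence, pow_add, Finset.prod_mul_distrib, mul_pow]
    rw [← h2, ← h2]
  rw [h3, matrixAmp, matrixAmp]
  push_cast
  rw [← Finset.prod_mul_distrib]
  refine Finset.prod_congr rfl fun e _ => ?_
  rw [h1, mul_pow]; ring

theorem integrable_prod_norm_pow (N : V → ℕ) :
    Integrable (fun u : V → Spinor => ∏ v, Real.sqrt (spinorNormSq (u v)) ^ N v)
      (Measure.pi fun _ => bargmann) :=
  Integrable.fintype_prod (f := fun v (u : Spinor) => Real.sqrt (spinorNormSq u) ^ N v)
    (μ := fun _ => bargmann) fun v => integrable_bargmann_norm_pow (N v)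

/-- The integral over the unitary group times the Gamma factors is a Gaussian integral. -/
theorem cohTerm_eq_integral (n : E → ℕ) (z : Dart E → Spinor) :
    Γ.cohTerm z n = ∫ u : V → Spinor, matrixAmp Γ n z (fun v => spinorMatrix (u v))
      ∂(Measure.pi fun _ : V => bargmann) := by
  set μ : Measure (V → Spinor) := Measure.pi fun _ : V => bargmann with hμ
  set ν : Measure (V → SU2) := Measure.pi fun _ : V => haarSU2 with hν
  let R : (V → Spinor) → ℝ := fun u => ∏ v, Real.sqrt (spinorNormSq (u v)) ^ valence Γ n v
  let G : (V → SU2) → (V → Spinor) → ℂ := fun h u =>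
    matrixAmp Γ n z (fun v => spinorMatrix (u v) * (h v).1)
  -- The unitary factor is only used at fixed `u`, so no measurable choice is needed.
  choose N hN using exists_su2_spinorMatrix
  have hG : ∀ h u, G h u =
      (R u : ℂ) * matrixAmp Γ n z (fun v => (((fun v => N (u v)) * h) v).1) := by
    intro h u
    simp only [G, R]
    rw [← matrixAmp_smul]
    congr 1
    funext v
    rw [hN (u v), Matrix.smul_mul]
    rfl
  -- Integrated over the spinors first, `h` disappears by unitary invariance of the Gaussian.
  have h1 : ∀ h, ∫ u, G h u ∂μ = ∫ u, matrixAmp Γ n z (fun v => spinorMatrix (u v)) ∂μ := by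
    intro h
    have hmp : MeasurePreserving (fun (u : V → Spinor) v => u v ᵥ* (h v).1) μ μ :=
      measurePreserving_pi _ _ fun v => measurePreserving_vecMul (h v)
    have hcont : Continuous fun u : V → Spinor => matrixAmp Γ n z (fun v => spinorMatrix (u v)) :=
      continuous_matrixAmp Γ n z fun v => continuous_spinorMatrix.comp (continuous_apply v)
    have h2 := integral_map (μ := μ) hmp.measurable.aemeasurable
      (f := fun u : V → Spinor => matrixAmp Γ n z (fun v => spinorMatrix (u v)))
      hcont.aestronglyMeasurable
    rw [hmp.map_eq] at h2
    rw [h2]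
    simp only [G, spinorMatrix_vecMul]
  -- Integrated over the group first, the unitary factor disappears by left invariance of Haar
  -- measure, and only the radial weight remains.
  have h2 : ∀ u, ∫ h, G h u ∂ν = (R u : ℂ) * Γ.spinAmp n z := by
    intro u
    simp only [hG]
    rw [integral_const_mul, spinAmp_eq]
    congr 1
    exact integral_mul_left_eq_self (μ := ν)
      (fun g : V → SU2 => matrixAmp Γ n z (fun v => (g v).1)) (fun v => N (u v))
  have hGc : Continuous (Function.uncurry G) := by
    refine continuous_matrixAmp Γ n z fun v => ?_
    exact (continuous_spinorMatrix.comp ((continuous_apply v).comp continuous_snd)).mul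
      (continuous_subtype_val.comp ((continuous_apply v).comp continuous_fst))
  have hint : Integrable (Function.uncurry G) (ν.prod μ) := by
    obtain ⟨C, hC⟩ := exists_bound_matrixAmp Γ n z
    have hR : Integrable (fun x : (V → SU2) × (V → Spinor) => C * R x.2) (ν.prod μ) :=
      (((integrable_prod_norm_pow (valence Γ n)).const_mul C).comp_snd ν)
    refine hR.mono' hGc.aestronglyMeasurable (ae_of_all _ fun x => ?_)
    have hRnn : 0 ≤ R x.2 := Finset.prod_nonneg fun v _ => by positivity
    rw [Function.uncurry, hG, norm_mul, Complex.norm_real, Real.norm_of_nonneg hRnn, mul_comm]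
    exact mul_le_mul_of_nonneg_right (hC _) hRnn
  have h3 := integral_integral_swap hint
  simp only [h1, h2] at h3
  rw [integral_const, integral_mul_const, integral_complex_ofReal] at h3
  have hprob : ν.real Set.univ = 1 := by simp [hν]
  rw [hprob, one_smul] at h3
  rw [h3, OGraph.cohTerm]
  congr 1
  have h4 : ∫ u, R u ∂μ = ∏ v, Real.Gamma (Γ.vertexSpin n v + 2) := by
    simp only [R, hμ]
    rw [integral_fintype_prod_eq_prod (𝕜 := ℝ) (f := fun v (u : Spinor) =>
      Real.sqrt (spinorNormSq u) ^ valence Γ n v) (μ := fun _ => bargmann)]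
    refine Finset.prod_congr rfl fun v _ => ?_
    rw [integral_bargmann_norm_pow, valence_div_two]
  rw [h4]
  push_cast; rfl

end Averaging

/-! ### Multiple exponential series. -/

section SumExchange

theorem tsum_pi_fin {R : Type*} [NormedField R] [CompleteSpace R] (m : ℕ) (f : Fin m → ℕ → R)
    (hf : ∀ i, Summable fun k => ‖f i k‖) :
    (Summable fun n : Fin m → ℕ => ‖∏ i, f i (n i)‖) ∧
      ∑' n : Fin m → ℕ, ∏ i, f i (n i) = ∏ i, ∑' k, f i k := by
  induction m with
  | zero => simp [Summable.of_finite]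
  | succ m ih =>
    obtain ⟨h1, h2⟩ := ih (fun i => f i.succ) fun i => hf i.succ
    let φ : ℕ × (Fin m → ℕ) ≃ (Fin (m + 1) → ℕ) := Fin.consEquiv fun _ => ℕ
    have hφ : ∀ x, ∏ i, f i (φ x i) = f 0 x.1 * ∏ i : Fin m, f i.succ (x.2 i) := by
      intro x
      rw [Fin.prod_univ_succ]
      simp [φ, Fin.consEquiv]
    have h0 := hf 0
    rw [Fin.prod_univ_succ, ← h2]
    generalize f 0 = f₀ at h0 hφ ⊢
    generalize hg : (fun n : Fin m → ℕ => ∏ i : Fin m, f i.succ (n i)) = g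
    have h1' : Summable fun n => ‖g n‖ := by rw [← hg]; exact h1
    have hφ' : ∀ x, ∏ i, f i (φ x i) = f₀ x.1 * g x.2 := by
      intro x; rw [hφ, ← hg]
    constructor
    · rw [← φ.summable_iff]
      simp only [Function.comp_def, hφ']
      exact h0.mul_norm h1'
    · rw [← φ.tsum_eq]
      simp only [hφ']
      exact (tsum_mul_tsum_of_summable_norm h0 h1').symm

theorem tsum_pi {R : Type*} [NormedField R] [CompleteSpace R] {ι : Type*} [Fintype ι]
    (f : ι → ℕ → R) (hf : ∀ i, Summable fun k => ‖f i k‖) :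
    (Summable fun n : ι → ℕ => ‖∏ i, f i (n i)‖) ∧
      ∑' n : ι → ℕ, ∏ i, f i (n i) = ∏ i, ∑' k, f i k := by
  let φ := (Fintype.equivFin ι).symm
  obtain ⟨h1, h2⟩ := tsum_pi_fin _ (fun i => f (φ i)) fun i => hf (φ i)
  let ψ : (Fin (Fintype.card ι) → ℕ) ≃ (ι → ℕ) := φ.arrowCongr (Equiv.refl ℕ)
  have hψ : ∀ n, ∏ i, f i (ψ n i) = ∏ i, f (φ i) (n i) := by
    intro n
    rw [← Equiv.prod_comp φ]
    simp [ψ]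
  constructor
  · rw [← ψ.summable_iff]
    simpa only [Function.comp_def, hψ] using h1
  · rw [← ψ.tsum_eq, ← Equiv.prod_comp φ, ← h2]
    simp only [hψ]

theorem tsum_prod_pow_div_factorial {ι : Type*} [Fintype ι] (q : ι → ℂ) :
    (Summable fun n : ι → ℕ => ‖∏ i, q i ^ n i / ((n i).factorial : ℂ)‖) ∧
      ∑' n : ι → ℕ, ∏ i, q i ^ n i / ((n i).factorial : ℂ) = Complex.exp (∑ i, q i) ∧
      ∑' n : ι → ℕ, ‖∏ i, q i ^ n i / ((n i).factorial : ℂ)‖ = Real.exp (∑ i, ‖q i‖) := by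
  have hs : ∀ i, Summable fun k : ℕ => ‖q i ^ k / (k.factorial : ℂ)‖ := by
    intro i
    simp only [norm_div, norm_pow, Complex.norm_natCast]
    exact Real.summable_pow_div_factorial _
  obtain ⟨h1, h2⟩ := tsum_pi (fun i (k : ℕ) => q i ^ k / (k.factorial : ℂ)) hs
  obtain ⟨-, h3⟩ := tsum_pi (R := ℝ) (fun i (k : ℕ) => ‖q i ^ k / (k.factorial : ℂ)‖)
    (by simpa using hs)
  refine ⟨h1, ?_, ?_⟩
  · rw [h2, Complex.exp_sum]
    refine Finset.prod_congr rfl fun i _ => ?_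
    rw [Complex.exp_eq_exp_ℂ, NormedSpace.exp_eq_tsum_div]
  · simp only [norm_prod]
    rw [h3, Real.exp_sum]
    refine Finset.prod_congr rfl fun i _ => ?_
    rw [Real.exp_eq_exp_ℝ, NormedSpace.exp_eq_tsum_div]
    simp

end SumExchange

/-! ### The Gaussian on the vertices and the sum for small spinors. -/

section DualGaussian

variable {V E : Type*} (Γ : OGraph V E)

/-- The combination of the vertex spinors that is coupled to a directed edge. -/
noncomputable def edgeLeg (z : Dart E → Spinor) (u : V → Spinor) (d : Dart E) : Spinor :=
  fun i => -z d 1 * u (Γ.start d) i + z d 0 * conjSpinor (u (Γ.start d)) i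

theorem edgeAmp_spinorMatrix (z : Dart E → Spinor) (u : V → Spinor) (e : E) :
    edgeAmp Γ z (fun v => spinorMatrix (u v)) e =
      bracket (edgeLeg Γ z u (e, true)) (edgeLeg Γ z u (e, false)) := by
  simp [edgeAmp, bracket, edgeLeg, spinorMatrix, Matrix.mulVec, dotProduct, Fin.sum_univ_two,
    Matrix.mul_apply, Matrix.conjTranspose_apply, conjSpinor, OGraph.start]
  ring

theorem spinorNormSq_edgeLeg_le {δ : ℝ} {z : Dart E → Spinor} (hz : ∀ d, ‖z d‖ ≤ δ)
    (u : V → Spinor) (d : Dart E) :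
    spinorNormSq (edgeLeg Γ z u d) ≤ 4 * δ ^ 2 * spinorNormSq (u (Γ.start d)) := by
  have hδ : 0 ≤ δ := (norm_nonneg _).trans (hz d)
  set x := u (Γ.start d)
  have h1 : ∀ i, ‖edgeLeg Γ z u d i‖ ≤ δ * (‖x 0‖ + ‖x 1‖) := by
    intro i
    have h2 : ‖edgeLeg Γ z u d i‖ ≤ ‖z d 1‖ * ‖x i‖ + ‖z d 0‖ * ‖conjSpinor x i‖ := by
      refine (norm_add_le _ _).trans ?_
      rw [norm_mul, norm_mul, norm_neg]
    refine h2.trans ?_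
    have h3 := (norm_le_pi_norm (z d) 0).trans (hz d)
    have h4 := (norm_le_pi_norm (z d) 1).trans (hz d)
    have h5 : ‖x i‖ + ‖conjSpinor x i‖ = ‖x 0‖ + ‖x 1‖ := by
      fin_cases i
      · simp [conjSpinor]
      · simp [conjSpinor, add_comm]
    rw [← h5, mul_add]
    exact add_le_add (mul_le_mul_of_nonneg_right h4 (norm_nonneg _))
      (mul_le_mul_of_nonneg_right h3 (norm_nonneg _))
  have h6 : ∀ i, ‖edgeLeg Γ z u d i‖ ^ 2 ≤ δ ^ 2 * (2 * spinorNormSq x) := by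
    intro i
    refine (pow_le_pow_left₀ (norm_nonneg _) (h1 i) 2).trans ?_
    rw [mul_pow]
    refine mul_le_mul_of_nonneg_left ?_ (sq_nonneg _)
    unfold spinorNormSq
    nlinarith [sq_nonneg (‖x 0‖ - ‖x 1‖)]
  rw [spinorNormSq]
  linarith [h6 0, h6 1]

theorem sum_incidence [Fintype V] [DecidableEq V] (z : Dart E → Spinor) (u : V → Spinor) (d : Dart E)
    (i : Fin 2) :
    ∑ a : Dart V, incidence Γ z a d * OGraph.legSpinor u a i = edgeLeg Γ z u d i := by
  rw [Fintype.sum_prod_type, Finset.sum_eq_single (Γ.start d)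
    (fun v _ hv => by simp [incidence, hv]) (by simp)]
  simp [incidence, edgeLeg, OGraph.legSpinor]

variable [Fintype V] [Fintype E]

/-- After summation over spins, the exponent is a coupling of one spinor per vertex, of the same
kind as the one on the edges. -/
theorem sum_edgeAmp [DecidableEq V] [DecidableEq E] (z : Dart E → Spinor) (u : V → Spinor) :
    ∑ e, edgeAmp Γ z (fun v => spinorMatrix (u v)) e = coupling (vertexMatrix Γ z) u := by
  have h1 : ∀ a b, vertexMatrix Γ z a b = ∑ e : E, (incidence Γ z a (e, true) *
      incidence Γ z b (e, false) - incidence Γ z a (e, false) * incidence Γ z b (e, true)) := by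
    intro a b
    rw [vertexMatrix, Matrix.neg_apply, Matrix.mul_assoc, Matrix.mul_apply, Fintype.sum_prod_type,
      ← Finset.sum_neg_distrib]
    refine Finset.sum_congr rfl fun e _ => ?_
    simp [edgeForm_mul_apply, dartSign, Dart.inv]
    ring
  have h2 : ∀ c d, bracket (edgeLeg Γ z u c) (edgeLeg Γ z u d) =
      ∑ a : Dart V, ∑ b : Dart V, incidence Γ z a c * incidence Γ z b d *
        bracket (OGraph.legSpinor u a) (OGraph.legSpinor u b) := by
    intro c d
    rw [bracket, ← sum_incidence, ← sum_incidence, ← sum_incidence, ← sum_incidence,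
      Finset.sum_mul_sum, Finset.sum_mul_sum, ← Finset.sum_sub_distrib]
    refine Finset.sum_congr rfl fun a _ => ?_
    rw [← Finset.sum_sub_distrib]
    refine Finset.sum_congr rfl fun b _ => ?_
    simp only [bracket]; ring
  have h3 : ∑ a : Dart V, ∑ b : Dart V, vertexMatrix Γ z a b *
      bracket (OGraph.legSpinor u a) (OGraph.legSpinor u b) =
      ∑ e : E, (bracket (edgeLeg Γ z u (e, true)) (edgeLeg Γ z u (e, false)) -
        bracket (edgeLeg Γ z u (e, false)) (edgeLeg Γ z u (e, true))) := by
    simp only [h2, ← Finset.sum_sub_distrib]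
    symm
    rw [Finset.sum_comm]
    refine Finset.sum_congr rfl fun a _ => ?_
    rw [Finset.sum_comm]
    refine Finset.sum_congr rfl fun b _ => ?_
    rw [h1, Finset.sum_mul]
    exact Finset.sum_congr rfl fun e _ => by ring
  rw [coupling, h3, Finset.mul_sum]
  refine Finset.sum_congr rfl fun e _ => ?_
  rw [edgeAmp_spinorMatrix, bracket_swap (edgeLeg Γ z u (e, true)) (edgeLeg Γ z u (e, false))]
  ring

theorem sum_norm_edgeAmp_le {δ : ℝ} {z : Dart E → Spinor} (hz : ∀ d, ‖z d‖ ≤ δ)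
    (hδ : 4 * δ ^ 2 * Fintype.card E ≤ 1 / 2) (u : V → Spinor) :
    ∑ e, ‖edgeAmp Γ z (fun v => spinorMatrix (u v)) e‖ ≤ 1 / 2 * ∑ v, spinorNormSq (u v) := by
  have hv : ∀ v, spinorNormSq (u v) ≤ ∑ v, spinorNormSq (u v) := fun v =>
    Finset.single_le_sum (f := fun v => spinorNormSq (u v))
      (fun v _ => spinorNormSq_nonneg _) (Finset.mem_univ v)
  have h1 : ∀ e, ‖edgeAmp Γ z (fun v => spinorMatrix (u v)) e‖ ≤
      4 * δ ^ 2 * ∑ v, spinorNormSq (u v) := by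
    intro e
    rw [edgeAmp_spinorMatrix]
    refine (norm_bracket_le _ _).trans ?_
    have h2 := (spinorNormSq_edgeLeg_le Γ hz u (e, true)).trans
      (mul_le_mul_of_nonneg_left (hv _) (by positivity))
    have h3 := (spinorNormSq_edgeLeg_le Γ hz u (e, false)).trans
      (mul_le_mul_of_nonneg_left (hv _) (by positivity))
    linarith
  refine (Finset.sum_le_sum fun e _ => h1 e).trans ?_
  rw [Finset.sum_const, Finset.card_univ, nsmul_eq_mul, ← mul_assoc]
  refine mul_le_mul_of_nonneg_right ?_ (Finset.sum_nonneg fun v _ => spinorNormSq_nonneg _)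
  linarith

/-- For small spinors the sum over spins converges to a Gaussian integral. -/
theorem hasSum_cohTerm_of_small [DecidableEq V] [DecidableEq E] {δ : ℝ} {z : Dart E → Spinor}
    (hz : ∀ d, ‖z d‖ ≤ δ) (hδ : 4 * δ ^ 2 * Fintype.card E ≤ 1 / 2) :
    (1 - vertexMatrix Γ z * edgeForm Finset.univ).det ≠ 0 ∧
      HasSum (Γ.cohTerm z) (1 / (1 - vertexMatrix Γ z * edgeForm Finset.univ).det) := by
  set μ : Measure (V → Spinor) := Measure.pi fun _ : V => bargmann with hμ
  let F : (E → ℕ) → (V → Spinor) → ℂ := fun n u =>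
    matrixAmp Γ n z (fun v => spinorMatrix (u v))
  have hF : ∀ u, (Summable fun n => ‖F n u‖) ∧
      ∑' n, F n u = Complex.exp (coupling (vertexMatrix Γ z) u) ∧
      ∑' n, ‖F n u‖ = Real.exp (∑ e, ‖edgeAmp Γ z (fun v => spinorMatrix (u v)) e‖) := by
    intro u
    have := tsum_prod_pow_div_factorial fun e => edgeAmp Γ z (fun v => spinorMatrix (u v)) e
    rwa [sum_edgeAmp] at this
  -- An integrable function dominates the whole series of absolute values, which justifies
  -- exchanging sum and integral.
  have hdom : ∀ u, ∑' n, ‖F n u‖ ≤ Real.exp (1 / 2 * ∑ v, spinorNormSq (u v)) := by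
    intro u
    rw [(hF u).2.2, Real.exp_le_exp]
    exact sum_norm_edgeAmp_le Γ hz hδ u
  have hcont : ∀ n, Continuous (F n) := fun n =>
    continuous_matrixAmp Γ n z fun v => continuous_spinorMatrix.comp (continuous_apply v)
  have hFint : ∀ n, Integrable (F n) μ := by
    intro n
    refine integrable_exp_half_normSq.mono' (hcont n).aestronglyMeasurable
      (ae_of_all _ fun u => ?_)
    exact ((hF u).1.le_tsum n fun _ _ => norm_nonneg _).trans (hdom u)
  have hsum : Summable fun n => ∫ u, ‖F n u‖ ∂μ := by
    refine summable_of_sum_le (c := ∫ u : V → Spinor,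
      Real.exp (1 / 2 * ∑ v, spinorNormSq (u v)) ∂μ)
      (fun n => integral_nonneg fun u => norm_nonneg _) fun s => ?_
    rw [← integral_finsetSum _ fun n _ => (hFint n).norm]
    refine integral_mono (integrable_finsetSum _ fun n _ => (hFint n).norm)
      integrable_exp_half_normSq fun u => ?_
    exact ((hF u).1.sum_le_tsum s fun _ _ => norm_nonneg _).trans (hdom u)
  have h := hasSum_integral_of_summable_integral_norm hFint hsum
  simp only [(hF _).2.1] at h
  have hexp : Integrable (fun u => Complex.exp (coupling (vertexMatrix Γ z) u)) μ := by
    refine integrable_exp_half_normSq.mono' (Complex.continuous_exp.comp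
      (continuous_coupling _)).aestronglyMeasurable (ae_of_all _ fun u => ?_)
    rw [← (hF u).2.1]
    exact (norm_tsum_le_tsum_norm (hF u).1).trans (hdom u)
  obtain ⟨h1, h2⟩ := integral_exp_coupling (vertexMatrix_transpose Γ z) hexp
  rw [h2] at h
  exact ⟨h1, (funext fun n => cohTerm_eq_integral Γ n z) ▸ h⟩

end DualGaussian

end SpinNetwork

namespace SpinNetwork

/-! ### Analytic continuation in the scale of the spinors. -/

section Continuation

variable {V E : Type*} [Fintype E] (Γ : OGraph V E)

theorem vertexMatrix_smul [DecidableEq V] [DecidableEq E] (c : ℂ) (z : Dart E → Spinor) :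
    vertexMatrix Γ (c • z) = c ^ 2 • vertexMatrix Γ z := by
  have h : incidence Γ (c • z) = c • incidence Γ z := by
    ext b d
    simp only [incidence, Matrix.of_apply, Matrix.smul_apply, Pi.smul_apply, smul_eq_mul]
    split_ifs <;> ring
  rw [vertexMatrix, vertexMatrix, h, Matrix.transpose_smul, Matrix.smul_mul, Matrix.smul_mul,
    Matrix.mul_smul, smul_smul, smul_neg, pow_two]

variable [Fintype V]

theorem cohTerm_smul (c : ℂ) (z : Dart E → Spinor) (n : E → ℕ) :
    Γ.cohTerm (c • z) n = c ^ (2 * ∑ e, n e) * Γ.cohTerm z n := by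
  have h : ∀ M, matrixAmp Γ n (c • z) M = c ^ (2 * ∑ e, n e) * matrixAmp Γ n z M := by
    intro M
    have h1 : ∀ e, edgeAmp Γ (c • z) M e = c ^ 2 * edgeAmp Γ z M e := by
      intro e
      simp only [edgeAmp, Pi.smul_apply, Matrix.mulVec_smul, bracket, smul_eq_mul]
      ring
    rw [matrixAmp, matrixAmp, pow_mul, ← Finset.prod_pow_eq_pow_sum, ← Finset.prod_mul_distrib]
    refine Finset.prod_congr rfl fun e _ => ?_
    rw [h1, mul_pow]; ring
  simp only [OGraph.cohTerm, spinAmp_eq, h]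
  rw [integral_const_mul]
  ring

/-- The sum over spins, wherever it converges. -/
theorem cohAmp_mul_det [DecidableEq V] [DecidableEq E] {z : Dart E → Spinor}
    (hz : Summable (Γ.cohTerm z)) :
    Γ.cohAmp z * (1 - vertexMatrix Γ z * edgeForm Finset.univ).det = 1 := by
  let P := (vertexMatrix Γ z * edgeForm Finset.univ).charpolyRev
  have hP : ∀ s : ℂ, (1 - s • (vertexMatrix Γ z * edgeForm Finset.univ)).det = P.eval s :=
    fun s => det_one_sub_smul s _
  let term : (E → ℕ) → ℂ → ℂ := fun n c => c ^ (2 * ∑ e, n e) * Γ.cohTerm z n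
  -- Here `term n c` is the term of the sum at the spinors `c • z`. Multiplying by the determinant
  -- rather than dividing avoids its possible zeros, and its nonvanishing becomes a consequence.
  let f : ℂ → ℂ := fun c => (∑' n, term n c) * P.eval (c ^ 2)
  have hbound : ∀ n, ∀ c ∈ Metric.closedBall (0 : ℂ) 1, ‖term n c‖ ≤ ‖Γ.cohTerm z n‖ := by
    intro n c hc
    rw [mem_closedBall_zero_iff] at hc
    rw [norm_mul, norm_pow]
    exact mul_le_of_le_one_left (norm_nonneg _) (pow_le_one₀ (norm_nonneg _) hc)
  have hPc : Differentiable ℂ fun c : ℂ => P.eval (c ^ 2) :=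
    P.differentiable.comp (differentiable_pow 2)
  have hcont : ContinuousOn f (Metric.closedBall 0 1) := by
    refine ContinuousOn.mul ?_ hPc.continuous.continuousOn
    refine continuousOn_tsum (fun n => ?_) hz.norm hbound
    exact ((continuous_pow _).mul continuous_const).continuousOn
  have hdiff : DifferentiableOn ℂ f (Metric.ball 0 1) := by
    refine DifferentiableOn.mul ?_ hPc.differentiableOn
    refine Complex.differentiableOn_tsum_of_summable_norm hz.norm (fun n => ?_) Metric.isOpen_ball
      fun n c hc => hbound n c (Metric.ball_subset_closedBall hc)
    exact ((differentiable_pow _).mul_const _).differentiableOn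
  have hsmall : f =ᶠ[nhds 0] fun _ => 1 := by
    let δ : ℝ := 1 / (4 * (Fintype.card E + 1))
    let B : ℝ := ‖z‖ + 1
    have hB : 0 < B := by positivity
    have hδ : 0 < δ := by positivity
    have hδ' : 4 * δ ^ 2 * Fintype.card E ≤ 1 / 2 := by
      simp only [δ]
      rw [div_pow, mul_pow, mul_div_assoc', div_mul_eq_mul_div, div_le_div_iff₀ (by positivity)
        (by norm_num)]
      nlinarith [(Fintype.card E).cast_nonneg (α := ℝ)]
    filter_upwards [Metric.ball_mem_nhds (0 : ℂ) (div_pos hδ hB)] with c hc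
    rw [mem_ball_zero_iff, lt_div_iff₀ hB] at hc
    have hcz : ∀ d, ‖(c • z) d‖ ≤ δ := by
      intro d
      rw [Pi.smul_apply, norm_smul]
      refine (mul_le_mul_of_nonneg_left (norm_le_pi_norm z d) (norm_nonneg c)).trans ?_
      refine (mul_le_mul_of_nonneg_left ?_ (norm_nonneg c)).trans hc.le
      simp [B]
    obtain ⟨h1, h2⟩ := hasSum_cohTerm_of_small Γ hcz hδ'
    have h3 := h2.tsum_eq
    rw [vertexMatrix_smul, Matrix.smul_mul, hP] at h1 h3
    simp only [cohTerm_smul] at h3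
    simp only [f, term, h3]
    field_simp
  -- For small `c` the spinors `c • z` are small enough for the Gaussian evaluation. The identity
  -- theorem extends `f = 1` to the open disc, and continuity then reaches `c = 1`, where
  -- summability at `z` itself dominates.
  have hball : Set.EqOn f (fun _ => 1) (Metric.ball 0 1) :=
    (hdiff.analyticOnNhd Metric.isOpen_ball).eqOn_of_preconnected_of_eventuallyEq
      analyticOnNhd_const (convex_ball (0 : ℂ) 1).isPreconnected (Metric.mem_ball_self one_pos)
      hsmall
  have hclosed : Set.EqOn f (fun _ => 1) (Metric.closedBall 0 1) :=
    hball.of_subset_closure hcont continuousOn_const Metric.ball_subset_closedBall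
      (by rw [closure_ball _ one_ne_zero])
  have h := hclosed (show (1 : ℂ) ∈ Metric.closedBall 0 1 by simp)
  simp only [f, term, one_pow, one_mul, ← hP, one_smul] at h
  exact h

end Continuation

end SpinNetwork
-- The main theorem.
theorem mainTheorem4 {V E : Type*} [Fintype V] [Fintype E] (Γ : OGraph V E) :
    -- for all sufficiently small spinors everything converges and the three expressions agree
    (∃ δ : ℝ, 0 < δ ∧ ∀ z : Dart E → Spinor, (∀ d, ‖z d‖ < δ) →
      Integrable (Γ.genIntegrand (spinorParam z)) (Measure.pi fun _ : E => bargmann) ∧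
      Summable (Γ.cohTerm z) ∧
      Γ.cycleSum z ≠ 0 ∧
      Γ.genFun (spinorParam z) = 1 / Γ.cycleSum z ^ 2 ∧
      1 / Γ.cycleSum z ^ 2 = Γ.cohAmp z) ∧
    -- the evaluation of the integral wherever it converges
    (∀ z : Dart E → Spinor,
      Integrable (Γ.genIntegrand (spinorParam z)) (Measure.pi fun _ : E => bargmann) →
      Γ.cycleSum z ≠ 0 ∧ Γ.genFun (spinorParam z) = 1 / Γ.cycleSum z ^ 2) ∧
    -- the evaluation of the sum over spins wherever it converges
    (∀ z : Dart E → Spinor, Summable (Γ.cohTerm z) →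
      Γ.cycleSum z ≠ 0 ∧ Γ.cohAmp z = 1 / Γ.cycleSum z ^ 2) ∧
    -- the parameters satisfy the Plücker relations at every vertex
    (∀ z : Dart E → Spinor, Γ.IsPlucker (spinorParam z)) ∧
    -- the Plücker relations make the configurations S, T, U at a vertex cancel
    (∀ T : Param E, Γ.IsPlucker T → ∀ (a b : Dart E) (p q : List (Dart E)),
      Γ.IsSimpleLoop ((a :: p) ++ (b :: q)) → Γ.start a = Γ.start b →
      Γ.IsSimpleLoop (a :: p) ∧ Γ.IsSimpleLoop (b :: q) ∧
      Γ.IsSimpleLoop ((a :: p) ++ revPath (b :: q)) ∧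
      pathAmp T (a :: p) * pathAmp T (b :: q)
        + pathAmp T ((a :: p) ++ revPath (b :: q))
        + pathAmp T ((a :: p) ++ (b :: q)) = 0) ∧
    -- in the sum over collections of edge-disjoint simple loops only disjoint cycle unions survive
    (∀ z : Dart E → Spinor,
      1 + ∑ L ∈ Γ.loopUnions, Γ.unionAmp (spinorParam z) L = Γ.cycleSum z) := by
  classical
  have hgen : ∀ z : Dart E → Spinor,
      Integrable (Γ.genIntegrand (spinorParam z)) (Measure.pi fun _ : E => bargmann) →
      Γ.cycleSum z ≠ 0 ∧ Γ.genFun (spinorParam z) = 1 / Γ.cycleSum z ^ 2 := by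
    intro z hz
    have he : Γ.genIntegrand (spinorParam z) =
        fun w => Complex.exp (coupling (Γ.localMatrix (spinorParam z)) w) :=
      funext fun w => genIntegrand_eq Γ _ w
    rw [he] at hz
    obtain ⟨h1, h2⟩ := integral_exp_coupling (Γ.localMatrix_transpose _) hz
    rw [← Γ.cycleSum_sq] at h1 h2
    refine ⟨fun h => h1 (by rw [h]; simp), ?_⟩
    rw [OGraph.genFun, he, h2]
  have hcoh : ∀ z : Dart E → Spinor, Summable (Γ.cohTerm z) →
      Γ.cycleSum z ≠ 0 ∧ Γ.cohAmp z = 1 / Γ.cycleSum z ^ 2 := by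
    intro z hz
    have h := cohAmp_mul_det Γ hz
    rw [← det_localMatrix_eq_vertexMatrix, ← Γ.cycleSum_sq] at h
    exact ⟨fun h0 => by simp [h0] at h, eq_one_div_of_mul_eq_one_left h⟩
  refine ⟨?_, hgen, hcoh, Γ.isPlucker_spinorParam, ?_, ?_⟩
  -- One condition, `4 δ² |E| ≤ 1/2`, serves both sides: the parameters are bounded by `2 δ²`, and
  -- the edge integral asks for `2 · (2 δ²) · |E| ≤ 1/2`.
  · have hδ : (0 : ℝ) < 1 / (4 * (Fintype.card E + 1)) := by positivity
    have hδ' : 4 * (1 / (4 * (Fintype.card E + 1)) : ℝ) ^ 2 * Fintype.card E ≤ 1 / 2 := by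
      rw [div_pow, mul_pow, mul_div_assoc', div_mul_eq_mul_div, div_le_div_iff₀ (by positivity)
        (by norm_num)]
      nlinarith [(Fintype.card E).cast_nonneg (α := ℝ)]
    refine ⟨_, hδ, fun z hz => ?_⟩
    generalize (1 / (4 * (Fintype.card E + 1)) : ℝ) = δ at hδ hδ' hz
    have hint : Integrable (Γ.genIntegrand (spinorParam z))
        (Measure.pi fun _ : E => bargmann) := by
      have hτ : ∀ a b, ‖Γ.localMatrix (spinorParam z) a b‖ ≤ 2 * δ ^ 2 := by
        intro a b
        rw [OGraph.localMatrix, Matrix.of_apply]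
        split_ifs
        · have hi : ∀ d i, ‖z d i‖ ≤ δ := fun d i => (norm_le_pi_norm (z d) i).trans (hz d).le
          refine (norm_sub_le _ _).trans ?_
          rw [norm_mul, norm_mul]
          have h1 := mul_le_mul (hi a 0) (hi b 1) (norm_nonneg _) hδ.le
          have h2 := mul_le_mul (hi a 1) (hi b 0) (norm_nonneg _) hδ.le
          linarith
        · rw [norm_zero]; positivity
      refine (integrable_exp_coupling hτ (by linarith)).congr (Filter.Eventually.of_forall fun w => ?_)
      exact (genIntegrand_eq Γ _ w).symm
    have hsum : Summable (Γ.cohTerm z) :=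
      (hasSum_cohTerm_of_small Γ (fun d => (hz d).le) hδ').2.summable
    exact ⟨hint, hsum, (hgen z hint).1, (hgen z hint).2, (hcoh z hsum).2.symm⟩
  · intro T hT a b p q h hab
    obtain ⟨h1, h2, h3⟩ := Γ.isSimpleLoop_split h hab
    exact ⟨h1, h2, h3, Γ.resolutions_cancel hT h hab⟩
  · intro z
    rw [← Γ.loopSum_univ, Γ.loopSum_spinorParam]
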